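/- Let $h=(h(0),\dots,h(L_h))$ be a real impulse response that is not identically zero, and consider the ISI channel \[ y(k)=\sum_{i=0}^{L_h}h(i)\bigl(x(k-i)+z(k-i)\bigr)+w(k),\qquad k\in\mathbb Z, \] in which the input $x$, the interference $z$ and the noise $w$ are mutually independent i.i.d. zero-mean Gaussian sequences with variances $\sigma_x^2>0$, $\sigma_z^2\ge 0$ and $\sigma_w^2\ge 0$, where $\sigma_z^2+\sigma_w^2>0$. For $L\ge 0$ let \[ \widetilde x_L(k)=\mathbf g^{T}\mathbf y_L(k),\qquad \mathbf y_L(k)=[y(k-L),\dots,y(k+L)]^T,\qquad \mathbf g=\mathrm E[\mathbf y_L(k)\mathbf y_L(k)^T]^{-1}\,\mathrm E[\mathbf y_L(k)x(k)], \] be the output of the LMMSE filter of order $2L$ that estimates $x(k)$. Write $\mathbf x^N=[x(0),\dots,x(N-1)]^T$, and similarly $\mathbf y^N$ and $\widetilde{\mathbf x}_L^N$, and let $I$ denote mutual information. Then LMMSE equalization loses no information at low SINR. Precisely, for every $\varepsilon>0$ there is a $\delta>0$, depending only on $h$ and $\varepsilon$, such that whenever $\sigma_x^2/(\sigma_z^2+\sigma_w^2)<\delta$: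 (a) for every $L$ such that $h(i)\ne0$ for some $i\le L$, and for all sufficiently large block lengths $N$, \[ \left|\frac{I(\mathbf x^N;\widetilde{\mathbf x}_L^N)}{I(\mathbf x^N;\mathbf y^N)}-1\right|<\varepsilon; \] (b) the same holds for symbol-by-symbol use of the output of a long filter: for all sufficiently large $L$ and then for all sufficiently large $N$ (depending on $L$), \[ \left|\frac{\sum_{k=0}^{N-1} I\bigl(x(k);\widetilde x_L(k)\bigr)}{I(\mathbf x^N;\mathbf y^N)}-1\right|<\varepsilon. \] -/

import Mathlib

open MeasureTheory ProbabilityTheory Filter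
open scoped NNReal ENNReal Matrix

noncomputable section

namespace ISIChannel

/-- The mutual information `I(X; Y)` (in nats) of two random variables: the Kullback-Leibler
divergence of the joint law from the product of the marginal laws. -/
def mutualInfo {Ω A B : Type*} [MeasurableSpace Ω] [MeasurableSpace A] [MeasurableSpace B]
    (μ : Measure Ω) (X : Ω → A) (Y : Ω → B) : ℝ≥0∞ :=
  InformationTheory.klDiv (μ.map fun ω => (X ω, Y ω)) ((μ.map X).prod (μ.map Y))

/-- The block `(u(0), …, u(N-1))` of a real random sequence `u`, as a random vector. -/
def block {Ω : Type*} (u : ℤ → Ω → ℝ) (N : ℕ) : Ω → (Fin N → ℝ) :=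
  fun ω k => u (k : ℤ) ω

/-- The sources of the channel: the input `x`, the interference `z` and the noise `w` are
sequences of centred Gaussian variables of variances `vx`, `vz`, `vw`, and all the variables
`x k`, `z k`, `w k` (`k : ℤ`) are mutually independent. -/
structure IsGaussianSource {Ω : Type*} [MeasurableSpace Ω] (μ : Measure Ω)
    (x z w : ℤ → Ω → ℝ) (vx vz vw : ℝ≥0) : Prop where
  law_x : ∀ k, HasLaw (x k) (gaussianReal 0 vx) μ
  law_z : ∀ k, HasLaw (z k) (gaussianReal 0 vz) μ
  law_w : ∀ k, HasLaw (w k) (gaussianReal 0 vw) μ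
  indep : iIndepFun (fun (p : Fin 3 × ℤ) => ![x, z, w] p.1 p.2) μ

/-- The channel output `y(k) = ∑ i, h(i) (x(k-i) + z(k-i)) + w(k)`, `0 ≤ i ≤ Lh`. -/
def channelOutput {Ω : Type*} {Lh : ℕ} (h : Fin (Lh + 1) → ℝ) (x z w : ℤ → Ω → ℝ) :
    ℤ → Ω → ℝ :=
  fun k ω => (∑ i : Fin (Lh + 1), h i * (x (k - (i : ℤ)) ω + z (k - (i : ℤ)) ω)) + w k ω

/-- The observation window `(y(k-L), …, y(k+L))` at time `k`. -/
def window {Ω : Type*} (y : ℤ → Ω → ℝ) (L : ℕ) (k : ℤ) (i : Fin (2 * L + 1)) : Ω → ℝ :=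
  y (k - (L : ℤ) + (i : ℤ))

/-- The vector of taps `E[𝐲(k) 𝐲(k)ᵀ]⁻¹ E[𝐲(k) x(k)]` of the linear minimum mean square error
filter of order `2 L` that estimates `x(k)` from `𝐲(k) = (y(k-L), …, y(k+L))`. -/
def lmmseTaps {Ω : Type*} [MeasurableSpace Ω] (μ : Measure Ω) (L : ℕ) (x y : ℤ → Ω → ℝ)
    (k : ℤ) : Fin (2 * L + 1) → ℝ :=
  (Matrix.of fun i j => ∫ ω, window y L k i ω * window y L k j ω ∂μ)⁻¹ *ᵥ
    fun i => ∫ ω, window y L k i ω * x k ω ∂μ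

/-- The output `x̃(k) = 𝐠ᵀ 𝐲(k)` of the linear minimum mean square error filter of
order `2 L`. -/
def lmmseOutput {Ω : Type*} [MeasurableSpace Ω] (μ : Measure Ω) (L : ℕ) (x y : ℤ → Ω → ℝ) :
    ℤ → Ω → ℝ :=
  fun k ω => ∑ i : Fin (2 * L + 1), lmmseTaps μ L x y k i * window y L k i ω

/-- The ratio `I(x; x̃) / I(x; y)` of the mutual informations of the blocks of length `N`. -/
def blockRatio {Ω : Type*} [MeasurableSpace Ω] (μ : Measure Ω) (N : ℕ)
    (x xt y : ℤ → Ω → ℝ) : ℝ :=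
  (mutualInfo μ (block x N) (block xt N)).toReal / (mutualInfo μ (block x N) (block y N)).toReal

/-- The ratio `(∑ k < N, I(x(k); x̃(k))) / I(x; y)`, in which the filtered channel `x → x̃` is
used symbol by symbol, as by a memoryless decoder, and `x`, `y` are blocks of length `N`. -/
def symbolRatio {Ω : Type*} [MeasurableSpace Ω] (μ : Measure Ω) (N : ℕ)
    (x xt y : ℤ → Ω → ℝ) : ℝ :=
  (∑ k ∈ Finset.range N, (mutualInfo μ (x (k : ℤ)) (xt (k : ℤ))).toReal) /
    (mutualInfo μ (block x N) (block y N)).toReal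

end ISIChannel

end

namespace ISIChannel

open scoped InnerProductSpace Topology

/-! ### Two-sided linear recurrences. -/

section Recurrence

/-! Jointly Gaussian variables are represented by vectors of a Hilbert space whose inner products
are the covariances. If X is white of variance s and Y is jointly Gaussian with it, then I(X;Y) = -½
∑ log(1 - λ_i), where the λ_i are the eigenvalues of the Gram matrix of the projections of the X_k
onto the span of Y, divided by s. At low SINR, projection onto a subspace of the span of y keeps at
most a fraction t of the energy of any combination of inputs
(`norm_sq_starProjection_le_of_channelVec`). Hence all λ_i ≤ t, and I equals ∑ λ_i / 2 up to a
factor between 1 and 1/(1-t); this sum is the total energy of the linear estimates of the X_k,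
divided by 2s (`toReal_mutualInfo_bounds`).

It remains to compare energies. By stationarity, the estimates from a block of length N have total
energy asymptotic to Nρ, where ρ is the energy of the projection of x(0) onto the closed span of the
whole observed sequence. For (a), filtering leaves that closed span unchanged
(`topologicalClosure_span_filter`): a vector orthogonal to the filtered sequence has square-summable
inner products with y which solve a linear recurrence, and a solution tending to zero vanishes
(`eq_zero_of_recurrence`). For (b), the energy captured by a window of half-width L tends to ρ,
uniformly in k. All the informations thus lie between (1-t) and 1/(1-t) times Nρ/(2σ_x²). -/

lemma eq_zero_of_recurrence_of_window {m : ℕ} {g : Fin m → ℝ} (hg : g ≠ 0) {u : ℤ → ℝ}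
    (hrec : ∀ k : ℤ, ∑ i, g i * u (k + (i : ℕ)) = 0) (h0 : ∀ i : Fin m, u ((i : ℕ) : ℤ) = 0) :
    u = 0 := by
  have hne : (Finset.univ.filter fun i => g i ≠ 0).Nonempty := by
    obtain ⟨i, hi⟩ := Function.ne_iff.1 hg
    exact ⟨i, by simpa using hi⟩
  -- The extreme indices `a ≤ b` of the support of `g`: placing `b` at position `j` determines `u j`
  -- from earlier values, placing `a` there determines it from later ones.
  obtain ⟨b, hb, hbmax⟩ := Finset.exists_max_image _ (fun i : Fin m => (i : ℕ)) hne
  obtain ⟨a, ha, hamin⟩ := Finset.exists_min_image _ (fun i : Fin m => (i : ℕ)) hne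
  simp only [Finset.mem_filter, Finset.mem_univ, true_and] at hb hbmax ha hamin
  have key : ∀ (k : ℤ) (i₀ : Fin m), g i₀ ≠ 0 →
      (∀ i, i ≠ i₀ → g i ≠ 0 → u (k + (i : ℕ)) = 0) → u (k + (i₀ : ℕ)) = 0 := by
    intro k i₀ hi₀ hz
    have h1 := hrec k
    rw [Finset.sum_eq_single i₀ (fun i _ hi => ?_) (by simp)] at h1
    · exact (mul_eq_zero.1 h1).resolve_left hi₀
    · by_cases hgi : g i = 0
      · simp [hgi]
      · simp [hz i hi hgi]
  have up : ∀ n : ℕ, ∀ j : ℤ, 0 ≤ j → j < m + n → u j = 0 := by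
    intro n
    induction n with
    | zero =>
      intro j hj hjm
      have := h0 ⟨j.toNat, by omega⟩
      simpa [Int.toNat_of_nonneg hj] using this
    | succ n ih =>
      intro j hj hjm
      by_cases hlt : j < m + n
      · exact ih j hj hlt
      have hk := key (j - (b : ℕ)) b hb (fun i hi hgi => by
        have h1 := hbmax i hgi
        have h2 : (i : ℕ) ≠ b := fun h => hi (Fin.ext h)
        have h3 := b.2
        exact ih _ (by omega) (by omega))
      simpa using hk
  have down : ∀ n : ℕ, ∀ j : ℤ, -(n : ℤ) ≤ j → j < m → u j = 0 := by
    intro n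
    induction n with
    | zero => intro j hj hjm; exact up 0 j (by omega) (by omega)
    | succ n ih =>
      intro j hj hjm
      by_cases hlt : -(n : ℤ) ≤ j
      · exact ih j hlt hjm
      have hk := key (j - (a : ℕ)) a ha (fun i hi hgi => by
        have h1 := hamin i hgi
        have h2 : (i : ℕ) ≠ a := fun h => hi (Fin.ext h)
        have h3 := i.2
        exact ih _ (by omega) (by omega))
      simpa using hk
  funext j
  rcases lt_or_ge j m with h | h
  · exact down j.natAbs j (by omega) h
  · exact up (j.natAbs + 1) j (by omega) (by omega)

/-- A linear map to a finite-dimensional space is bounded below on a subspace on which it is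
injective. -/
lemma exists_norm_le_mul_norm_of_injOn {E F : Type*} [NormedAddCommGroup E] [NormedSpace ℝ E]
    [NormedAddCommGroup F] [NormedSpace ℝ F] [FiniteDimensional ℝ F] (V : Submodule ℝ E)
    (φ : E →ₗ[ℝ] F) (hφ : ∀ f ∈ V, φ f = 0 → f = 0) :
    ∃ K : ℝ, ∀ f ∈ V, ‖f‖ ≤ K * ‖φ f‖ := by
  have hker : LinearMap.ker (φ.domRestrict V) = ⊥ :=
    LinearMap.ker_eq_bot'.2 fun f hf => Subtype.ext (hφ f f.2 hf)
  -- `V` embeds in `F`, so it is finite-dimensional and an injective linear map on it is bounded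
  -- below.
  have : FiniteDimensional ℝ V :=
    Module.Finite.of_injective (φ.domRestrict V) (LinearMap.ker_eq_bot.1 hker)
  obtain ⟨K, -, hK⟩ := (φ.domRestrict V).exists_antilipschitzWith hker
  refine ⟨K, fun f hf => ?_⟩
  simpa using hK.le_mul_dist ⟨f, hf⟩ 0

/-- A two-sided solution of a nontrivial linear recurrence with constant coefficients that tends
to zero at infinity vanishes. -/
lemma eq_zero_of_recurrence {m : ℕ} {g : Fin m → ℝ} (hg : g ≠ 0) {u : ℤ → ℝ}
    (hrec : ∀ k : ℤ, ∑ i, g i * u (k + (i : ℕ)) = 0) (hu : Tendsto u cofinite (𝓝 0)) :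
    u = 0 := by
  -- On bounded solutions, the sup norm is controlled by the values on a window of length `m`.
  obtain ⟨K, hK⟩ := exists_norm_le_mul_norm_of_injOn (E := BoundedContinuousFunction ℤ ℝ)
    (F := Fin m → ℝ)
    { carrier := {f | ∀ k : ℤ, ∑ i, g i * f (k + (i : ℕ)) = 0}
      add_mem' := fun {f f'} hf hf' k => by
        have : ∀ i : Fin m, g i * (f + f') (k + (i : ℕ))
            = g i * f (k + (i : ℕ)) + g i * f' (k + (i : ℕ)) := fun i => mul_add _ _ _
        simp only [this, Finset.sum_add_distrib]
        rw [hf k, hf' k, add_zero]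
      zero_mem' := fun k => by simp
      smul_mem' := fun c f hf k => by
        have : ∀ i : Fin m, g i * (c • f) (k + (i : ℕ)) = c * (g i * f (k + (i : ℕ))) :=
          fun i => mul_left_comm _ _ _
        simp only [this, ← Finset.mul_sum]
        rw [hf k, mul_zero] }
    { toFun := fun f i => f ((i : ℕ) : ℤ)
      map_add' := fun f f' => rfl
      map_smul' := fun c f => rfl }
    (fun f hf h0 => by
      have := eq_zero_of_recurrence_of_window hg hf (fun i => congrFun h0 i)
      ext k
      exact congrFun this k)
  have hbd : ∃ C, ∀ k, |u k| ≤ C := by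
    have h1 : ∀ᶠ k in cofinite, |u k| ≤ 1 := by
      filter_upwards [(hu.abs).eventually (ge_mem_nhds (by simp : |(0 : ℝ)| < 1))] with k hk
      exact hk
    have hfin : {k | ¬ |u k| ≤ 1}.Finite := h1
    refine ⟨1 + ∑ k ∈ hfin.toFinset, |u k|, fun k => ?_⟩
    by_cases hk : |u k| ≤ 1
    · exact hk.trans (le_add_of_nonneg_right (Finset.sum_nonneg fun _ _ => abs_nonneg _))
    · have := Finset.single_le_sum (f := fun k => |u k|) (fun _ _ => abs_nonneg _)
        (hfin.mem_toFinset.2 hk)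
      linarith
  obtain ⟨C, hC⟩ := hbd
  -- Translates of `u` are again solutions, with the same `K`. The window can therefore be sent to
  -- infinity, where `u` tends to zero.
  let U : ℤ → BoundedContinuousFunction ℤ ℝ := fun n =>
    BoundedContinuousFunction.ofNormedAddCommGroup (fun k => u (k + n))
      continuous_of_discreteTopology C (fun k => hC _)
  have hle : ∀ k n, |u k| ≤ K * ‖fun i : Fin m => u ((i : ℕ) + n)‖ := by
    intro k n
    have h1 := hK (U n) fun k => by simpa [U, add_right_comm] using hrec (k + n)
    have h2 := (U n).norm_coe_le_norm (k - n)
    simp only [U, BoundedContinuousFunction.coe_ofNormedAddCommGroup, sub_add_cancel,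
      Real.norm_eq_abs] at h2
    exact h2.trans h1
  have hlim : Tendsto (fun n : ℕ => K * ‖fun i : Fin m => u ((i : ℕ) + (n : ℤ))‖) atTop
      (𝓝 0) := by
    have h1 : Tendsto (fun n : ℕ => fun i : Fin m => u ((i : ℕ) + (n : ℤ))) atTop (𝓝 0) := by
      rw [tendsto_pi_nhds]
      intro i
      have hinj : Function.Injective (fun n : ℕ => ((i : ℕ) : ℤ) + (n : ℤ)) := by
        intro a b hab
        simpa using hab
      have h2 := hu.comp hinj.tendsto_cofinite
      rw [Nat.cofinite_eq_atTop] at h2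
      exact h2
    simpa using (h1.norm).const_mul K
  funext k
  have h3 : |u k| ≤ 0 := ge_of_tendsto' hlim (fun n => hle k n)
  simpa using h3

end Recurrence

/-! ### Stationary sequences in Hilbert space and the energy of linear estimates. -/

section Stationary

variable {H : Type*} [NormedAddCommGroup H] [InnerProductSpace ℝ H]

instance hasOrthogonalProjection_span_range {ι : Type*} [Finite ι] (f : ι → H) :
    (Submodule.span ℝ (Set.range f)).HasOrthogonalProjection := by
  have := FiniteDimensional.span_of_finite ℝ (Set.finite_range f)
  infer_instance

/-- The sequence `x` has constant norm and the pair of sequences `(x, u)` in an inner product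
space has shift-invariant inner products. -/
structure JointlyStationary (x u : ℤ → H) : Prop where
  norm_left : ∀ k, ‖x k‖ = ‖x 0‖
  inner_left_right : ∀ a b t, ⟪x (a + t), u (b + t)⟫_ℝ = ⟪x a, u b⟫_ℝ
  inner_right_right : ∀ a b t, ⟪u (a + t), u (b + t)⟫_ℝ = ⟪u a, u b⟫_ℝ

namespace JointlyStationary

variable {x u : ℤ → H}

/-- Expanding the square leaves only norms and inner products that the shift preserves. -/
lemma norm_sub_sum_shift (hxu : JointlyStationary x u) (k : ℤ) (S : Finset ℤ) (c : ℤ → ℝ) :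
    ‖x k - ∑ j ∈ S, c j • u (j + k)‖ = ‖x 0 - ∑ j ∈ S, c j • u j‖ := by
  have h1 : ∀ j, ⟪x k, u (j + k)⟫_ℝ = ⟪x 0, u j⟫_ℝ := fun j => by
    simpa using hxu.inner_left_right 0 j k
  have key : ‖x k - ∑ j ∈ S, c j • u (j + k)‖ ^ 2 = ‖x 0 - ∑ j ∈ S, c j • u j‖ ^ 2 := by
    rw [norm_sub_sq_real, norm_sub_sq_real, hxu.norm_left k]
    simp only [← real_inner_self_eq_norm_sq (∑ j ∈ S, _), inner_sum, sum_inner, inner_smul_left,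
      inner_smul_right, h1, hxu.inner_right_right]
  exact (pow_left_inj₀ (norm_nonneg _) (norm_nonneg _) two_ne_zero).1 key

lemma norm_sub_linearCombination_shift (hxu : JointlyStationary x u) (k : ℤ) (c : ℤ →₀ ℝ) :
    ‖x k - c.sum fun j a => a • u (j + k)‖ = ‖x 0 - c.sum fun j a => a • u j‖ :=
  hxu.norm_sub_sum_shift k c.support c

/-- Filtering the second sequence preserves joint stationarity. -/
lemma filter (hxu : JointlyStationary x u) {ι : Type*} (s : Finset ι) (g : ι → ℝ) (d : ι → ℤ) :
    JointlyStationary x (fun k => ∑ i ∈ s, g i • u (k + d i)) where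
  norm_left := hxu.norm_left
  inner_left_right a b t := by
    simp only [inner_sum, inner_smul_right]
    refine Finset.sum_congr rfl fun i _ => ?_
    rw [add_right_comm, hxu.inner_left_right]
  inner_right_right a b t := by
    simp only [inner_sum, sum_inner, inner_smul_right, inner_smul_left, add_right_comm _ t,
      hxu.inner_right_right]

lemma norm_sq_starProjection (W : Submodule ℝ H) [W.HasOrthogonalProjection] (v : H) :
    ‖W.starProjection v‖ ^ 2 = ‖v‖ ^ 2 - ‖v - W.starProjection v‖ ^ 2 := by
  have h := Submodule.norm_sq_eq_add_norm_sq_starProjection v W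
  rw [Submodule.starProjection_orthogonal] at h
  simp at h
  linarith

lemma norm_sub_starProjection_le (W : Submodule ℝ H) [W.HasOrthogonalProjection] (v : H) {w : H}
    (hw : w ∈ W) : ‖v - W.starProjection v‖ ≤ ‖v - w‖ := by
  rw [Submodule.starProjection_minimal]
  exact ciInf_le ⟨0, by rintro _ ⟨x, rfl⟩; positivity⟩ (⟨w, hw⟩ : W)

variable [CompleteSpace H]

/-- The energy of the best estimate of `x 0` from the whole sequence `u`. -/
noncomputable def limitEnergy (x u : ℤ → H) : ℝ :=
  ‖(Submodule.span ℝ (Set.range u)).topologicalClosure.starProjection (x 0)‖ ^ 2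

/-- Captured energy is total energy minus squared error. Shifted by `-k`, the estimate of `x k`
becomes a competitor for `x 0` in the closed span, where the error is minimal. -/
lemma norm_sq_starProjection_le (hxu : JointlyStationary x u) (W : Submodule ℝ H)
    [W.HasOrthogonalProjection] (hW : W ≤ Submodule.span ℝ (Set.range u)) (k : ℤ) :
    ‖W.starProjection (x k)‖ ^ 2 ≤ limitEnergy x u := by
  set K := (Submodule.span ℝ (Set.range u)).topologicalClosure with hK
  rw [limitEnergy, norm_sq_starProjection, norm_sq_starProjection, hxu.norm_left k]
  obtain ⟨c, hc⟩ := Finsupp.mem_span_range_iff_exists_finsupp.1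
    (hW (Submodule.starProjection_apply_mem W (x k)))
  let c' : ℤ →₀ ℝ := c.mapDomain (fun j => j - k)
  have hc' : (c'.sum fun j a => a • u (j + k)) = W.starProjection (x k) := by
    rw [Finsupp.sum_mapDomain_index (by simp) (by intros; rw [add_smul])]
    simpa using hc
  have h1 := hxu.norm_sub_linearCombination_shift k c'
  rw [hc'] at h1
  have h2 : ‖x 0 - K.starProjection (x 0)‖ ≤ ‖x 0 - c'.sum fun j a => a • u j‖ :=
    norm_sub_starProjection_le K _ (Submodule.le_topologicalClosure _
      (Finsupp.mem_span_range_iff_exists_finsupp.2 ⟨c', rfl⟩))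
  rw [h1]
  gcongr

/-- A finite combination is nearly optimal for `x 0`; its shifts are equally good for every `x k`,
so a single support `S` serves all times. -/
lemma exists_finset_le_norm_sq_starProjection (hxu : JointlyStationary x u) {η : ℝ} (hη : 0 < η) :
    ∃ S : Finset ℤ, ∀ (k : ℤ) (W : Submodule ℝ H) [W.HasOrthogonalProjection],
      (∀ j ∈ S, u (j + k) ∈ W) → limitEnergy x u - η ≤ ‖W.starProjection (x k)‖ ^ 2 := by
  set K := (Submodule.span ℝ (Set.range u)).topologicalClosure with hK
  have hmem : K.starProjection (x 0) ∈ closure (Submodule.span ℝ (Set.range u) : Set H) := by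
    rw [← Submodule.topologicalClosure_coe]
    exact Submodule.starProjection_apply_mem K (x 0)
  have hcont : Continuous fun w : H => ‖x 0 - w‖ ^ 2 := by fun_prop
  have hopen : IsOpen {w : H | ‖x 0 - w‖ ^ 2 < ‖x 0 - K.starProjection (x 0)‖ ^ 2 + η} :=
    isOpen_lt hcont continuous_const
  obtain ⟨w, hw, hwS⟩ := mem_closure_iff.1 hmem _ hopen (by simpa using hη)
  obtain ⟨c, hc⟩ := Finsupp.mem_span_range_iff_exists_finsupp.1 hwS
  refine ⟨c.support, fun k W _ hW => ?_⟩
  rw [limitEnergy, norm_sq_starProjection, norm_sq_starProjection W, hxu.norm_left k]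
  have h1 := hxu.norm_sub_linearCombination_shift k c
  rw [hc] at h1
  have h2 := norm_sub_starProjection_le W (x k) (w := c.sum fun j a => a • u (j + k))
    (Submodule.sum_mem _ fun j hj => W.smul_mem _ (hW j hj))
  rw [h1] at h2
  have h3 : ‖x k - W.starProjection (x k)‖ ^ 2 ≤ ‖x 0 - w‖ ^ 2 := by gcongr
  simp only [Set.mem_ofPred_eq] at hw
  linarith

/-- The total energy of the estimates of `x 0, …, x (N-1)` from `u 0, …, u (N-1)` is
asymptotically `N` times the limit energy. -/
lemma eventually_le_sum_norm_sq_starProjection (hxu : JointlyStationary x u) {η : ℝ}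
    (hη : 0 < η) : ∀ᶠ N : ℕ in atTop, N * (limitEnergy x u - η) ≤
      ∑ k : Fin N, ‖(Submodule.span ℝ (Set.range fun j : Fin N => u ((j : ℕ) : ℤ))).starProjection
        (x ((k : ℕ) : ℤ))‖ ^ 2 := by
  obtain ⟨S, hS⟩ := hxu.exists_finset_le_norm_sq_starProjection (half_pos hη)
  set ρ := limitEnergy x u with hρ
  have hρ0 : 0 ≤ ρ := by rw [hρ, limitEnergy]; positivity
  -- Only times within `B` of an end of the block can miss part of the shifted support. Each end
  -- loses at most `B * ρ`, and both losses together are at most `N * (η / 2)` for large `N`.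
  obtain ⟨B, hB⟩ : ∃ B : ℕ, ∀ j ∈ S, j.natAbs ≤ B :=
    ⟨S.sup Int.natAbs, fun j hj => Finset.le_sup (f := Int.natAbs) hj⟩
  have hlarge : ∀ᶠ N : ℕ in atTop, 2 * B * ρ ≤ N * (η / 2) :=
    (tendsto_natCast_atTop_atTop.atTop_mul_const (half_pos hη)).eventually_ge_atTop _
  filter_upwards [hlarge] with N hN
  have hterm : ∀ k : Fin N, (ρ - η / 2) - (if (k : ℕ) < B then ρ else 0)
      - (if N ≤ (k : ℕ) + B then ρ else 0) ≤
      ‖(Submodule.span ℝ (Set.range fun j : Fin N => u ((j : ℕ) : ℤ))).starProjection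
        (x ((k : ℕ) : ℤ))‖ ^ 2 := by
    intro k
    by_cases h1 : (k : ℕ) < B
    · rw [if_pos h1]
      have : 0 ≤ (if N ≤ (k : ℕ) + B then ρ else 0) := by split_ifs <;> simp [hρ0]
      have h2 := sq_nonneg
        ‖(Submodule.span ℝ (Set.range fun j : Fin N => u ((j : ℕ) : ℤ))).starProjection
        (x ((k : ℕ) : ℤ))‖
      linarith
    by_cases h2 : N ≤ (k : ℕ) + B
    · rw [if_neg h1, if_pos h2]
      have h2 := sq_nonneg
        ‖(Submodule.span ℝ (Set.range fun j : Fin N => u ((j : ℕ) : ℤ))).starProjection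
        (x ((k : ℕ) : ℤ))‖
      linarith
    rw [if_neg h1, if_neg h2, sub_zero, sub_zero]
    refine hS _ _ fun j hj => Submodule.subset_span ⟨⟨(j + (k : ℕ)).toNat, ?_⟩, ?_⟩
    · have := hB j hj
      omega
    · have := hB j hj
      simp only
      congr 1
      omega
  have hcard1 : ∑ k : Fin N, (if (k : ℕ) < B then ρ else 0) ≤ B * ρ := by
    rw [Fin.sum_univ_eq_sum_range (fun k => if k < B then ρ else 0), ← Finset.sum_filter,
      Finset.sum_const, nsmul_eq_mul]
    gcongr
    calc _ ≤ (Finset.range B).card := Finset.card_le_card fun k hk => by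
            simp at hk ⊢; omega
      _ = B := Finset.card_range B
  have hcard2 : ∑ k : Fin N, (if N ≤ (k : ℕ) + B then ρ else 0) ≤ B * ρ := by
    rw [Fin.sum_univ_eq_sum_range (fun k => if N ≤ k + B then ρ else 0), ← Finset.sum_filter,
      Finset.sum_const, nsmul_eq_mul]
    gcongr
    calc _ ≤ (Finset.Ico (N - B) N).card := Finset.card_le_card fun k hk => by
            simp at hk ⊢; omega
      _ ≤ B := by rw [Nat.card_Ico]; omega
  have hsum := Finset.sum_le_sum fun k (_ : k ∈ Finset.univ) => hterm k
  simp only [Finset.sum_sub_distrib, Finset.sum_const, Finset.card_univ, Fintype.card_fin,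
    nsmul_eq_mul] at hsum
  nlinarith

lemma sum_norm_sq_starProjection_le (hxu : JointlyStationary x u) (N : ℕ) :
    ∑ k : Fin N, ‖(Submodule.span ℝ (Set.range fun j : Fin N => u ((j : ℕ) : ℤ))).starProjection
        (x ((k : ℕ) : ℤ))‖ ^ 2 ≤ N * limitEnergy x u := by
  have := Finset.sum_le_sum fun (k : Fin N) (_ : k ∈ Finset.univ) =>
    hxu.norm_sq_starProjection_le
      (Submodule.span ℝ (Set.range fun j : Fin N => u ((j : ℕ) : ℤ)))
      (Submodule.span_mono (by rintro _ ⟨j, rfl⟩; exact ⟨_, rfl⟩)) ((k : ℕ) : ℤ)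
  simpa using this

end JointlyStationary

variable [CompleteSpace H]

/-- Filtering a Bessel sequence with a nonzero finite filter does not change its closed span. -/
lemma topologicalClosure_span_filter {u : ℤ → H} {K : ℝ}
    (hK : ∀ (S : Finset ℤ) (c : ℤ → ℝ), ‖∑ j ∈ S, c j • u j‖ ^ 2 ≤ K * ∑ j ∈ S, c j ^ 2)
    {m : ℕ} {g : Fin m → ℝ} (hg : g ≠ 0) (d : ℤ) :
    (Submodule.span ℝ (Set.range fun k : ℤ => ∑ i, g i • u (k - d + (i : ℕ)))).topologicalClosure
      = (Submodule.span ℝ (Set.range u)).topologicalClosure := by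
  -- It suffices to compare orthogonal complements.
  rw [← Submodule.orthogonal_orthogonal_eq_closure, ← Submodule.orthogonal_orthogonal_eq_closure]
  congr 1
  apply le_antisymm
  · intro v hv
    have hv' : ∀ k : ℤ, ∑ i, g i * ⟪v, u (k + (i : ℕ))⟫_ℝ = 0 := by
      intro k
      have := (Submodule.mem_orthogonal' _ _).1 hv _ (Submodule.subset_span ⟨k + d, rfl⟩)
      simpa [inner_sum, inner_smul_right] using this
    -- Bessel's inequality by duality: `T = ⟪v, ∑ ⟪v, u j⟫ u j⟫`, so Cauchy–Schwarz and `hK` give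
    -- `T² ≤ ‖v‖² K T`.
    have hbound : ∀ S : Finset ℤ, ∑ j ∈ S, ⟪v, u j⟫_ℝ ^ 2 ≤ ‖v‖ ^ 2 * K := by
      intro S
      set T := ∑ j ∈ S, ⟪v, u j⟫_ℝ ^ 2 with hT
      have hT0 : 0 ≤ T := Finset.sum_nonneg fun _ _ => sq_nonneg _
      have h1 : T = ⟪v, ∑ j ∈ S, ⟪v, u j⟫_ℝ • u j⟫_ℝ := by
        simp only [inner_sum, inner_smul_right, hT, sq]
      have h2 := hK S (fun j => ⟪v, u j⟫_ℝ)
      have h3 := abs_real_inner_le_norm v (∑ j ∈ S, ⟪v, u j⟫_ℝ • u j)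
      rw [← h1, abs_of_nonneg hT0] at h3
      have h4 : T ^ 2 ≤ ‖v‖ ^ 2 * (K * T) := by
        calc T ^ 2 ≤ (‖v‖ * ‖∑ j ∈ S, ⟪v, u j⟫_ℝ • u j‖) ^ 2 := by gcongr
          _ = ‖v‖ ^ 2 * ‖∑ j ∈ S, ⟪v, u j⟫_ℝ • u j‖ ^ 2 := by ring
          _ ≤ _ := by gcongr
      rcases hT0.eq_or_lt with h0 | h0
      · have hK0 : 0 ≤ K := by
          have := hK {0} (fun _ => 1)
          simp at this
          exact (sq_nonneg _).trans this
        rw [← h0]; positivity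
      · nlinarith
    have hsum : Summable fun j => ⟪v, u j⟫_ℝ ^ 2 :=
      summable_of_sum_le (fun _ => sq_nonneg _) hbound
    have hlim : Tendsto (fun j => ⟪v, u j⟫_ℝ) cofinite (𝓝 0) := by
      have h1 := (hsum.tendsto_cofinite_zero).sqrt
      simp only [Real.sqrt_sq_eq_abs, Real.sqrt_zero] at h1
      exact (tendsto_zero_iff_abs_tendsto_zero _).2 h1
    have h0 := eq_zero_of_recurrence hg hv' hlim
    rw [Submodule.mem_orthogonal']
    intro w hw
    induction hw using Submodule.span_induction with
    | mem w hw => obtain ⟨k, rfl⟩ := hw; exact congrFun h0 k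
    | zero => simp
    | add a b _ _ ha hb => rw [inner_add_right, ha, hb, add_zero]
    | smul c a _ ha => rw [inner_smul_right, ha, mul_zero]
  · apply Submodule.orthogonal_le
    rw [Submodule.span_le]
    rintro _ ⟨k, rfl⟩
    exact Submodule.sum_mem _ fun i _ => Submodule.smul_mem _ _ (Submodule.subset_span ⟨_, rfl⟩)

end Stationary

/-! ### Invariance of mutual information. -/

section MutualInformation

/-- The data processing inequality, applied to `e` and to its inverse. -/
lemma klDiv_map_measurableEquiv {A B : Type*} [MeasurableSpace A] [MeasurableSpace B]
    (P Q : Measure A) [IsFiniteMeasure P] [IsFiniteMeasure Q] (e : A ≃ᵐ B) :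
    InformationTheory.klDiv (P.map e) (Q.map e) = InformationTheory.klDiv P Q := by
  apply le_antisymm (InformationTheory.klDiv_map_le P Q e.measurable)
  have h := InformationTheory.klDiv_map_le (P.map e) (Q.map e) e.symm.measurable
  rwa [Measure.map_map e.symm.measurable e.measurable,
    Measure.map_map e.symm.measurable e.measurable, e.symm_comp_self, Measure.map_id,
    Measure.map_id] at h

variable {Ω : Type*} [MeasurableSpace Ω] {μ : Measure Ω} [IsProbabilityMeasure μ]

/-- Mutual information is invariant under invertible transformations of both variables. -/
lemma mutualInfo_comp_measurableEquiv {A A' B B' : Type*} [MeasurableSpace A] [MeasurableSpace A']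
    [MeasurableSpace B] [MeasurableSpace B'] {X : Ω → A} {Y : Ω → B} (hX : AEMeasurable X μ)
    (hY : AEMeasurable Y μ) (e : A ≃ᵐ A') (e' : B ≃ᵐ B') :
    mutualInfo μ (fun ω => e (X ω)) (fun ω => e' (Y ω)) = mutualInfo μ X Y := by
  have := Measure.isProbabilityMeasure_map hX
  have := Measure.isProbabilityMeasure_map hY
  have := Measure.isProbabilityMeasure_map (hX.prodMk hY)
  rw [mutualInfo, mutualInfo, ← klDiv_map_measurableEquiv _ _ (e.prodCongr e')]
  congr 1
  · rw [AEMeasurable.map_map_of_aemeasurable (e.prodCongr e').measurable.aemeasurable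
      (hX.prodMk hY)]
    rfl
  · have h1 : μ.map (fun ω => e (X ω)) = (μ.map X).map e :=
      (AEMeasurable.map_map_of_aemeasurable e.measurable.aemeasurable hX).symm
    have h2 : μ.map (fun ω => e' (Y ω)) = (μ.map Y).map e' :=
      (AEMeasurable.map_map_of_aemeasurable e'.measurable.aemeasurable hY).symm
    rw [h1, h2, Measure.map_prod_map _ _ e.measurable e'.measurable]
    rfl

end MutualInformation

/-! ### Densities of Gaussian product measures. -/

section GaussianDensity

lemma gaussianReal_eq_withDensity_gaussianReal (m m' : ℝ) {v v' : ℝ≥0} (hv : v ≠ 0)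
    (hv' : v' ≠ 0) : gaussianReal m v =
      (gaussianReal m' v').withDensity fun x => gaussianPDF m v x / gaussianPDF m' v' x := by
  have h := withDensity_mul volume (measurable_gaussianPDF m' v')
    ((measurable_gaussianPDF m v).div (measurable_gaussianPDF m' v'))
  rw [gaussianReal_of_var_ne_zero m hv, gaussianReal_of_var_ne_zero m' hv']
  refine Eq.trans ?_ h
  congr 1
  ext x
  exact (ENNReal.mul_div_cancel (gaussianPDF_pos m' hv' x).ne' gaussianPDF_ne_top).symm

/-- On boxes the indicator factorises over the coordinates, which are independent under the product
measure. -/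
lemma pi_withDensity {ι : Type*} [Fintype ι] {E : ι → Type*} [∀ i, MeasurableSpace (E i)]
    (ν : ∀ i, Measure (E i)) [∀ i, IsProbabilityMeasure (ν i)] {f : ∀ i, E i → ℝ≥0∞}
    (hf : ∀ i, Measurable (f i)) [∀ i, SigmaFinite ((ν i).withDensity (f i))] :
    Measure.pi (fun i => (ν i).withDensity (f i)) =
      (Measure.pi ν).withDensity fun x => ∏ i, f i (x i) := by
  symm
  refine (Measure.pi_eq fun s hs => ?_).symm
  have hms : MeasurableSet (Set.univ.pi s) := MeasurableSet.univ_pi hs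
  rw [withDensity_apply _ hms, ← lintegral_indicator hms]
  have hind : ∀ x : ∀ i, E i, (Set.univ.pi s).indicator (fun x => ∏ i, f i (x i)) x =
      ∏ i, (s i).indicator (f i) (x i) := by
    intro x
    classical
    by_cases hx : x ∈ Set.univ.pi s
    · rw [Set.indicator_of_mem hx]
      exact Finset.prod_congr rfl fun i _ =>
        (Set.indicator_of_mem (hx i (Set.mem_univ i)) _).symm
    · rw [Set.indicator_of_notMem hx]
      simp only [Set.mem_pi, Set.mem_univ, true_imp_iff, not_forall] at hx
      obtain ⟨i, hi⟩ := hx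
      exact (Finset.prod_eq_zero (Finset.mem_univ i) (Set.indicator_of_notMem hi _)).symm
  simp_rw [hind]
  have hm : ∀ i, Measurable ((s i).indicator (f i)) := fun i => (hf i).indicator (hs i)
  rw [lintegral_prod_eq_prod_lintegral_of_indepFun Finset.univ
    (fun i (x : ∀ i, E i) => (s i).indicator (f i) (x i))
    (iIndepFun_pi fun i => (hm i).aemeasurable) (fun i => (hm i).comp (measurable_pi_apply i))]
  refine Finset.prod_congr rfl fun i _ => ?_
  rw [withDensity_apply _ (hs i), ← lintegral_indicator (hs i)]
  exact (measurePreserving_eval ν i).lintegral_comp (hm i)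

/-- The density of the Gaussian vector with independent components of means `a i` and variances
`v i`, with respect to the centred one with variances `s i`. -/
noncomputable def gaussianRatio {ι : Type*} [Fintype ι] (v s : ι → ℝ≥0) (a x : ι → ℝ) : ℝ≥0∞ :=
  ∏ i, gaussianPDF (a i) (v i) (x i) / gaussianPDF 0 (s i) (x i)

variable {ι : Type*} [Fintype ι] {v s : ι → ℝ≥0}

lemma measurable_gaussianRatio {β : Type*} [MeasurableSpace β] {V : β → ι → ℝ}
    (hV : Measurable V) :
    Measurable fun p : (ι → ℝ) × β => gaussianRatio v s (V p.2) p.1 := by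
  refine Finset.measurable_prod _ fun i _ => ?_
  have h1 : Measurable fun p : (ι → ℝ) × β => p.1 i := (measurable_pi_apply i).comp measurable_fst
  have h2 : Measurable fun p : (ι → ℝ) × β => V p.2 i :=
    (measurable_pi_apply i).comp (hV.comp measurable_snd)
  exact (measurable_uncurry_gaussianPDF.comp (h2.prodMk (measurable_const.prodMk h1))).div
    ((measurable_gaussianPDF _ _).comp h1)

lemma pi_gaussianReal_eq_withDensity (hv : ∀ i, v i ≠ 0) (hs : ∀ i, s i ≠ 0) (a : ι → ℝ) :
    Measure.pi (fun i => gaussianReal (a i) (v i)) =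
      (Measure.pi fun i => gaussianReal 0 (s i)).withDensity (gaussianRatio v s a) := by
  have h : ∀ i, gaussianReal (a i) (v i) = (gaussianReal 0 (s i)).withDensity
      fun x => gaussianPDF (a i) (v i) x / gaussianPDF 0 (s i) x :=
    fun i => gaussianReal_eq_withDensity_gaussianReal _ _ (hv i) (hs i)
  have : ∀ i, SigmaFinite ((gaussianReal 0 (s i)).withDensity
      fun x => gaussianPDF (a i) (v i) x / gaussianPDF 0 (s i) x) := fun i => by
    rw [← h i]; infer_instance
  calc Measure.pi (fun i => gaussianReal (a i) (v i)) = Measure.pi (fun i =>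
        (gaussianReal 0 (s i)).withDensity
          fun x => gaussianPDF (a i) (v i) x / gaussianPDF 0 (s i) x) := by
        congr 1; funext i; exact h i
    _ = _ := pi_withDensity _ fun i => (measurable_gaussianPDF _ _).div (measurable_gaussianPDF _ _)

lemma map_add_pi_gaussianReal (a : ι → ℝ) :
    (Measure.pi fun i => gaussianReal 0 (v i)).map (fun e => a + e) =
      Measure.pi fun i => gaussianReal (a i) (v i) := by
  have h := Measure.pi_map_pi (μ := fun i => gaussianReal 0 (v i))
    (f := fun i (x : ℝ) => a i + x) (fun i => by fun_prop)
  have h2 : ∀ i, (gaussianReal 0 (v i)).map (fun x => a i + x) = gaussianReal (a i) (v i) := by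
    intro i; rw [gaussianReal_map_const_add, zero_add]
  simp only [h2] at h
  exact h

/-- The joint law of `(V Y + E, Y)`, with `E` a Gaussian vector independent of `Y`, has an explicit
density with respect to a product measure. -/
lemma map_prod_pi_gaussianReal_eq_withDensity {β : Type*} [MeasurableSpace β] (ρ : Measure β)
    [IsProbabilityMeasure ρ] {V : β → ι → ℝ} (hV : Measurable V) (hv : ∀ i, v i ≠ 0)
    (hs : ∀ i, s i ≠ 0) :
    ((Measure.pi fun i => gaussianReal 0 (v i)).prod ρ).map (fun p => (V p.2 + p.1, p.2)) =
      ((Measure.pi fun i => gaussianReal 0 (s i)).prod ρ).withDensity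
        fun p => gaussianRatio v s (V p.2) p.1 := by
  have hT : Measurable fun p : (ι → ℝ) × β => (V p.2 + p.1, p.2) := by fun_prop
  have hR := measurable_gaussianRatio (v := v) (s := s) hV
  ext A hA
  rw [Measure.map_apply hT hA, Measure.prod_apply_symm (hT hA), withDensity_apply _ hA,
    ← lintegral_indicator hA, lintegral_prod_symm _ (hR.indicator hA).aemeasurable]
  -- For fixed `y` the shear is a translation by `V y`, which only moves the mean of the Gaussian
  -- vector.
  refine lintegral_congr fun y => ?_
  have hAy : MeasurableSet ((fun x : ι → ℝ => (x, y)) ⁻¹' A) := measurable_prodMk_right hA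
  have h1 : (fun x : ι → ℝ => (x, y)) ⁻¹' ((fun p : (ι → ℝ) × β => (V p.2 + p.1, p.2)) ⁻¹' A) =
      (fun e => V y + e) ⁻¹' ((fun x : ι → ℝ => (x, y)) ⁻¹' A) := rfl
  rw [h1, ← Measure.map_apply (by fun_prop) hAy, map_add_pi_gaussianReal,
    pi_gaussianReal_eq_withDensity hv hs, withDensity_apply _ hAy, ← lintegral_indicator hAy]
  rfl

lemma log_gaussianPDFReal (m : ℝ) {v : ℝ≥0} (hv : v ≠ 0) (x : ℝ) :
    Real.log (gaussianPDFReal m v x) =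
      -(Real.log (2 * Real.pi) + Real.log v) / 2 - (x - m) ^ 2 / (2 * v) := by
  have hv' : (0 : ℝ) < v := by positivity
  rw [gaussianPDFReal, Real.log_mul (by positivity) (by positivity), Real.log_exp, Real.log_inv,
    Real.log_sqrt (by positivity), Real.log_mul (by positivity) hv'.ne']
  ring

lemma log_toReal_gaussianRatio (hv : ∀ i, v i ≠ 0) (hs : ∀ i, s i ≠ 0) (a x : ι → ℝ) :
    Real.log (gaussianRatio v s a x).toReal =
      ∑ i, ((Real.log (s i) - Real.log (v i)) / 2 - (x i - a i) ^ 2 / (2 * v i)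
        + x i ^ 2 / (2 * s i)) := by
  have hpos : ∀ i, 0 < gaussianPDFReal (a i) (v i) (x i) := fun i => gaussianPDFReal_pos _ _ _ (hv i)
  have hpos' : ∀ i, 0 < gaussianPDFReal 0 (s i) (x i) := fun i => gaussianPDFReal_pos _ _ _ (hs i)
  rw [gaussianRatio, ENNReal.toReal_prod, Real.log_prod]
  · refine Finset.sum_congr rfl fun i _ => ?_
    rw [ENNReal.toReal_div, toReal_gaussianPDF, toReal_gaussianPDF,
      Real.log_div (hpos i).ne' (hpos' i).ne', log_gaussianPDFReal _ (hv i),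
      log_gaussianPDFReal _ (hs i)]
    ring
  · intro i _
    rw [ENNReal.toReal_div, toReal_gaussianPDF, toReal_gaussianPDF]
    exact (div_pos (hpos i) (hpos' i)).ne'

end GaussianDensity

/-! ### Mutual information of an additive Gaussian channel. -/

section GaussianInformation

variable {Ω : Type*} [MeasurableSpace Ω] {μ : Measure Ω}

lemma integrable_sq_and_integral_sq_of_hasLaw_gaussianReal {X : Ω → ℝ} {v : ℝ≥0}
    (hX : HasLaw X (gaussianReal 0 v) μ) :
    Integrable (fun ω => X ω ^ 2) μ ∧ ∫ ω, X ω ^ 2 ∂μ = v := by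
  have h2 : MemLp X 2 μ := by
    have := memLp_id_gaussianReal (μ := 0) (v := v) 2
    rw [← hX.map_eq] at this
    exact (memLp_map_measure_iff (by fun_prop) hX.aemeasurable).1 this
  refine ⟨h2.integrable_sq, ?_⟩
  have hvar := variance_id_gaussianReal (μ := 0) (v := v)
  rw [variance_eq_integral (by fun_prop)] at hvar
  rw [← hvar, ← hX.map_eq, integral_map hX.aemeasurable (by fun_prop)]
  rw [hX.map_eq]
  simp

/-- The mutual information of `X = V(Y) + E` and `Y` when `E` is independent of `Y` and both `X`
and `E` are centred Gaussian vectors with independent components. -/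
lemma toReal_mutualInfo_of_hasLaw_pi [IsProbabilityMeasure μ] {ι β : Type*} [Fintype ι] [MeasurableSpace β]
    {X E : Ω → ι → ℝ} {Y : Ω → β} {V : β → ι → ℝ} {v s : ι → ℝ≥0} (hV : Measurable V)
    (hY : AEMeasurable Y μ) (hv : ∀ i, v i ≠ 0) (hs : ∀ i, s i ≠ 0)
    (hX : HasLaw X (Measure.pi fun i => gaussianReal 0 (s i)) μ)
    (hE : HasLaw E (Measure.pi fun i => gaussianReal 0 (v i)) μ) (hind : IndepFun E Y μ)
    (hXE : ∀ ω, X ω = V (Y ω) + E ω) :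
    (mutualInfo μ X Y).toReal = ∑ i, (Real.log (s i) - Real.log (v i)) / 2 := by
  have := Measure.isProbabilityMeasure_map hY
  set P := μ.map fun ω => (X ω, Y ω) with hP
  set Q := (Measure.pi fun i => gaussianReal 0 (s i)).prod (μ.map Y) with hQ
  have hT : Measurable fun p : (ι → ℝ) × β => (V p.2 + p.1, p.2) := by fun_prop
  have hR := measurable_gaussianRatio (v := v) (s := s) hV
  -- The joint law of `(X, Y)` is the image of the product law of `(E, Y)` under the shear `(e, y) ↦
  -- (V y + e, y)`.
  have hPQ : P = Q.withDensity fun p => gaussianRatio v s (V p.2) p.1 := by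
    rw [hQ, ← map_prod_pi_gaussianReal_eq_withDensity (μ.map Y) hV hv hs, ← hE.map_eq,
      ← (indepFun_iff_map_prod_eq_prod_map_map hE.aemeasurable hY).1 hind,
      AEMeasurable.map_map_of_aemeasurable hT.aemeasurable (hE.aemeasurable.prodMk hY), hP]
    congr 1
    funext ω
    simp [hXE]
  have hac : P ≪ Q := by rw [hPQ]; exact withDensity_absolutelyContinuous _ _
  have hprob : IsProbabilityMeasure P :=
    Measure.isProbabilityMeasure_map (hX.aemeasurable.prodMk hY)
  have hXY : AEMeasurable (fun ω => (X ω, Y ω)) μ := hX.aemeasurable.prodMk hY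
  have hrn : P.rnDeriv Q =ᵐ[P] fun p => gaussianRatio v s (V p.2) p.1 := by
    have h := Measure.rnDeriv_withDensity Q hR
    rw [← hPQ] at h
    exact hac.ae_le h
  have hXi : ∀ i, HasLaw (fun ω => X ω i) (gaussianReal 0 (s i)) μ := fun i =>
    (HasLaw.mk (measurable_pi_apply i).aemeasurable (measurePreserving_eval _ i).map_eq :
      HasLaw (Function.eval i) _ (Measure.pi fun i => gaussianReal 0 (s i))).comp hX
  have hEi : ∀ i, HasLaw (fun ω => E ω i) (gaussianReal 0 (v i)) μ := fun i =>
    (HasLaw.mk (measurable_pi_apply i).aemeasurable (measurePreserving_eval _ i).map_eq :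
      HasLaw (Function.eval i) _ (Measure.pi fun i => gaussianReal 0 (v i))).comp hE
  rw [mutualInfo, hX.map_eq, InformationTheory.toReal_klDiv_of_measure_eq hac (by simp)]
  have hllr : llr P Q =ᵐ[P] fun p => Real.log (gaussianRatio v s (V p.2) p.1).toReal := by
    filter_upwards [hrn] with p hp
    rw [llr, hp]
  have hlog : Measurable fun p : (ι → ℝ) × β => Real.log (gaussianRatio v s (V p.2) p.1).toReal :=
    Real.measurable_log.comp hR.ennreal_toReal
  rw [integral_congr_ae hllr, hP, integral_map hXY hlog.aestronglyMeasurable]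
  simp only [log_toReal_gaussianRatio hv hs]
  have hsub : ∀ ω i, X ω i - V (Y ω) i = E ω i := fun ω i => by simp [hXE]
  simp only [hsub]
  have h1 := fun i => integrable_sq_and_integral_sq_of_hasLaw_gaussianReal (hXi i)
  have h2 := fun i => integrable_sq_and_integral_sq_of_hasLaw_gaussianReal (hEi i)
  have hc : ∀ i, Integrable (fun ω => (Real.log (s i) - Real.log (v i)) / 2
      - E ω i ^ 2 / (2 * v i)) μ :=
    fun i => (integrable_const _).sub ((h2 i).1.div_const _)
  have hcd : ∀ i, Integrable (fun ω => (Real.log (s i) - Real.log (v i)) / 2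
      - E ω i ^ 2 / (2 * v i) + X ω i ^ 2 / (2 * s i)) μ :=
    fun i => (hc i).add ((h1 i).1.div_const _)
  rw [integral_finsetSum _ fun i _ => hcd i]
  refine Finset.sum_congr rfl fun i _ => ?_
  -- The quadratic terms have means `-1/2` and `1/2`, which cancel.
  rw [integral_add (hc i) ((h1 i).1.div_const _),
    integral_sub (integrable_const _) ((h2 i).1.div_const _),
    integral_const, integral_div, integral_div, (h1 i).2, (h2 i).2]
  have hvi : (v i : ℝ) ≠ 0 := by exact_mod_cast hv i
  have hsi : (s i : ℝ) ≠ 0 := by exact_mod_cast hs i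
  simp
  field_simp
  ring

end GaussianInformation

/-! ### Gaussian families as Hilbert space vectors; information versus energy. -/

section Isonormal

variable {Ω E H : Type*} [MeasurableSpace Ω] [AddCommGroup E] [Module ℝ E]
  [NormedAddCommGroup H] [InnerProductSpace ℝ H]

/-- A linear family `B` of centred jointly Gaussian random variables whose covariances are the
inner products of the vectors given by `Ψ`. -/
structure IsIsonormal (μ : Measure Ω) (B : E →ₗ[ℝ] (Ω → ℝ)) (Ψ : E →ₗ[ℝ] H) : Prop where
  gaussian : IsGaussianProcess (fun c ω => B c ω) μ
  mean : ∀ c, ∫ ω, B c ω ∂μ = 0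
  integral_mul : ∀ c d, ∫ ω, B c ω * B d ω ∂μ = ⟪Ψ c, Ψ d⟫_ℝ

namespace IsIsonormal

variable {μ : Measure Ω} [IsProbabilityMeasure μ] {B : E →ₗ[ℝ] (Ω → ℝ)} {Ψ : E →ₗ[ℝ] H}

omit [IsProbabilityMeasure μ] in
lemma aemeasurable (hB : IsIsonormal μ B Ψ) (c : E) : AEMeasurable (B c) μ :=
  hB.gaussian.aemeasurable c

lemma covariance_eq (hB : IsIsonormal μ B Ψ) (c d : E) : cov[B c, B d; μ] = ⟪Ψ c, Ψ d⟫_ℝ := by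
  rw [covariance_eq_sub (hB.gaussian.hasGaussianLaw_eval c).memLp_two
    (hB.gaussian.hasGaussianLaw_eval d).memLp_two, hB.mean c, zero_mul, sub_zero,
    ← hB.integral_mul]
  rfl

lemma hasLaw_gaussianReal (hB : IsIsonormal μ B Ψ) (c : E) {v : ℝ≥0}
    (hv : ⟪Ψ c, Ψ c⟫_ℝ = v) : HasLaw (B c) (gaussianReal 0 v) μ where
  aemeasurable := hB.aemeasurable c
  map_eq := by
    rw [(hB.gaussian.hasGaussianLaw_eval c).map_eq_gaussianReal]
    have h1 : Var[B c; μ] = v := by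
      rw [← covariance_self (hB.aemeasurable c), hB.covariance_eq, hv]
    rw [h1, Real.toNNReal_coe]
    congr 1
    exact hB.mean c

variable {ι κ : Type*} [Fintype ι] [Fintype κ]

omit [IsProbabilityMeasure μ] [Fintype ι] in
lemma hasGaussianLaw_pi [Finite ι] (hB : IsIsonormal μ B Ψ) (Z : ι → E) :
    HasGaussianLaw (fun ω i => B (Z i) ω) μ := by
  have := Fintype.ofFinite ι
  let L : ({i // i ∈ (Finset.univ : Finset ι)} → ℝ) →L[ℝ] (ι → ℝ) :=
    { toFun := fun x i => x ⟨i, Finset.mem_univ i⟩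
      map_add' := fun _ _ => rfl
      map_smul' := fun _ _ => rfl }
  exact ((hB.gaussian.comp_right Z).hasGaussianLaw Finset.univ).map L

/-- Uncorrelated jointly Gaussian variables are independent. -/
lemma hasLaw_pi_gaussianReal (hB : IsIsonormal μ B Ψ) (Z : ι → E) {v : ι → ℝ≥0}
    (hv : ∀ i, ⟪Ψ (Z i), Ψ (Z i)⟫_ℝ = v i) (hne : ∀ i j, i ≠ j → ⟪Ψ (Z i), Ψ (Z j)⟫_ℝ = 0) :
    HasLaw (fun ω i => B (Z i) ω) (Measure.pi fun i => gaussianReal 0 (v i)) μ where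
  aemeasurable := (hB.hasGaussianLaw_pi Z).aemeasurable
  map_eq := by
    have hind := (hB.hasGaussianLaw_pi Z).iIndepFun_of_covariance_eq_zero fun i j hij => by
      rw [hB.covariance_eq, hne i j hij]
    rw [(iIndepFun_iff_map_fun_eq_pi_map fun i => hB.aemeasurable (Z i)).1 hind]
    congr 1
    funext i
    exact (hB.hasLaw_gaussianReal (Z i) (hv i)).map_eq

omit [Fintype ι] [Fintype κ] in
lemma indepFun (hB : IsIsonormal μ B Ψ) (Z : ι → E) (Y : κ → E)
    (h : ∀ i j, ⟪Ψ (Z i), Ψ (Y j)⟫_ℝ = 0) :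
    IndepFun (fun ω i => B (Z i) ω) (fun ω j => B (Y j) ω) μ := by
  refine IsGaussianProcess.indepFun_of_covariance_eq_zero
    ((hB.gaussian.comp_right (Sum.elim Z Y)).congr fun t => ?_)
    (fun i => hB.aemeasurable _) (fun j => hB.aemeasurable _) fun i j => ?_
  · cases t <;> rfl
  · rw [← h i j, ← hB.covariance_eq]

lemma inner_starProjection_left (W : Submodule ℝ H) [W.HasOrthogonalProjection] (a b : H) :
    ⟪W.starProjection a, b⟫_ℝ = ⟪W.starProjection a, W.starProjection b⟫_ℝ := by
  have h : ⟪W.starProjection a, b - W.starProjection b⟫_ℝ = 0 := by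
    rw [real_inner_comm]
    exact W.starProjection_inner_eq_zero b _ (W.starProjection_apply_mem a)
  rw [inner_sub_right] at h
  linarith

/-- Mutual information of two Gaussian vectors in canonical coordinates for the first one. -/
lemma toReal_mutualInfo_of_orthogonal (hB : IsIsonormal μ B Ψ) {X : ι → E} {Y : κ → E}
    {s : ℝ} (hs : 0 < s) {l : ι → ℝ} (hl : ∀ i, l i < 1)
    (hX : ∀ i, ⟪Ψ (X i), Ψ (X i)⟫_ℝ = s) (hXne : ∀ i j, i ≠ j → ⟪Ψ (X i), Ψ (X j)⟫_ℝ = 0)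
    (hP : ∀ i, ‖(Submodule.span ℝ (Set.range fun j => Ψ (Y j))).starProjection (Ψ (X i))‖ ^ 2
      = s * l i)
    (hPne : ∀ i j, i ≠ j →
      ⟪(Submodule.span ℝ (Set.range fun j => Ψ (Y j))).starProjection (Ψ (X i)),
      (Submodule.span ℝ (Set.range fun j => Ψ (Y j))).starProjection (Ψ (X j))⟫_ℝ = 0) :
    (mutualInfo μ (fun ω i => B (X i) ω) (fun ω j => B (Y j) ω)).toReal
      = ∑ i, -Real.log (1 - l i) / 2 := by
  set W := Submodule.span ℝ (Set.range fun j => Ψ (Y j)) with hW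
  have hA : ∀ i, ∃ a : κ → ℝ, ∑ j, a j • Ψ (Y j) = W.starProjection (Ψ (X i)) := fun i =>
    (Submodule.mem_span_range_iff_exists_fun ℝ).1 (W.starProjection_apply_mem (Ψ (X i)))
  choose A hA using hA
  set V : ι → E := fun i => ∑ j, A i j • Y j with hV
  set R : ι → E := fun i => X i - V i with hR
  have hΨV : ∀ i, Ψ (V i) = W.starProjection (Ψ (X i)) := fun i => by
    rw [← hA i, hV, map_sum]
    simp
  have hΨR : ∀ i, Ψ (R i) = Ψ (X i) - W.starProjection (Ψ (X i)) := fun i => by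
    rw [hR, map_sub, hΨV]
  have hRR : ∀ i j, ⟪Ψ (R i), Ψ (R j)⟫_ℝ = ⟪Ψ (X i), Ψ (X j)⟫_ℝ
      - ⟪W.starProjection (Ψ (X i)), W.starProjection (Ψ (X j))⟫_ℝ := by
    intro i j
    have h1 := inner_starProjection_left W (Ψ (X i)) (Ψ (X j))
    have h2 := inner_starProjection_left W (Ψ (X j)) (Ψ (X i))
    rw [real_inner_comm] at h2
    rw [real_inner_comm (W.starProjection (Ψ (X i)))] at h2
    rw [hΨR, hΨR, inner_sub_left, inner_sub_right, inner_sub_right, h1, h2]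
    ring
  have hRY : ∀ i j, ⟪Ψ (R i), Ψ (Y j)⟫_ℝ = 0 := fun i j => by
    rw [hΨR]
    exact W.starProjection_inner_eq_zero _ _ (Submodule.subset_span ⟨j, rfl⟩)
  have hv : ∀ i, 0 < s * (1 - l i) := fun i => mul_pos hs (by linarith [hl i])
  have key := toReal_mutualInfo_of_hasLaw_pi (μ := μ)
    (X := fun ω i => B (X i) ω) (E := fun ω i => B (R i) ω) (Y := fun ω j => B (Y j) ω)
    (V := fun y i => ∑ j, A i j * y j) (v := fun i => (s * (1 - l i)).toNNReal)
    (s := fun _ => s.toNNReal) (by fun_prop) (hB.hasGaussianLaw_pi Y).aemeasurable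
    (fun i => (Real.toNNReal_pos.2 (hv i)).ne')
    (fun i => (Real.toNNReal_pos.2 hs).ne')
    (hB.hasLaw_pi_gaussianReal X (fun i => by rw [hX, Real.coe_toNNReal _ hs.le]) hXne)
    (hB.hasLaw_pi_gaussianReal R
      (fun i => by rw [hRR, hX, real_inner_self_eq_norm_sq, hP, Real.coe_toNNReal _ (hv i).le]; ring)
      (fun i j hij => by rw [hRR, hXne i j hij, hPne i j hij, sub_zero]))
    (hB.indepFun R Y hRY)
    (fun ω => by
      funext i
      simp only [Pi.add_apply, hR, hV, map_sub, map_sum, map_smul, Pi.sub_apply, Finset.sum_apply,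
        Pi.smul_apply, smul_eq_mul]
      ring)
  rw [key]
  refine Finset.sum_congr rfl fun i _ => ?_
  have hli : 0 < 1 - l i := by linarith [hl i]
  rw [Real.coe_toNNReal _ hs.le, Real.coe_toNNReal _ (hv i).le, Real.log_mul hs.ne' hli.ne']
  ring

/-- Both bounds come from `log y ≤ y - 1`, at `y = 1 - t` and at `y = (1 - t)⁻¹`. -/
lemma log_one_sub_bounds {t θ : ℝ} (ht : 0 ≤ t) (htθ : t ≤ θ) (hθ : θ < 1) :
    t ≤ -Real.log (1 - t) ∧ -Real.log (1 - t) ≤ t / (1 - θ) := by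
  have h1 : 0 < 1 - t := by linarith
  have h2 : 0 < 1 - θ := by linarith
  refine ⟨by linarith [Real.log_le_sub_one_of_pos h1], ?_⟩
  have h3 := Real.log_le_sub_one_of_pos (inv_pos.2 h1)
  rw [Real.log_inv] at h3
  have h4 : (1 - t)⁻¹ - 1 = t / (1 - t) := by field_simp; ring
  rw [h4] at h3
  exact h3.trans (by gcongr)

/-- Mutual information of a white Gaussian vector `X` and a jointly Gaussian vector `Y`, when `Y`
determines at most the fraction `θ` of the energy of every linear combination of `X`. -/
lemma toReal_mutualInfo_bounds (hB : IsIsonormal μ B Ψ) {X : ι → E} {Y : κ → E} {s θ : ℝ}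
    (hs : 0 < s) (hθ : θ < 1) (hX : ∀ i, ⟪Ψ (X i), Ψ (X i)⟫_ℝ = s)
    (hXne : ∀ i j, i ≠ j → ⟪Ψ (X i), Ψ (X j)⟫_ℝ = 0)
    (hP : ∀ e ∈ Submodule.span ℝ (Set.range fun i => Ψ (X i)),
      ‖(Submodule.span ℝ (Set.range fun j => Ψ (Y j))).starProjection e‖ ^ 2 ≤ θ * ‖e‖ ^ 2) :
    (∑ i, ‖(Submodule.span ℝ (Set.range fun j => Ψ (Y j))).starProjection (Ψ (X i))‖ ^ 2)
        / (2 * s) ≤ (mutualInfo μ (fun ω i => B (X i) ω) (fun ω j => B (Y j) ω)).toReal ∧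
    (mutualInfo μ (fun ω i => B (X i) ω) (fun ω j => B (Y j) ω)).toReal ≤
      (∑ i, ‖(Submodule.span ℝ (Set.range fun j => Ψ (Y j))).starProjection (Ψ (X i))‖ ^ 2)
        / (2 * s * (1 - θ)) := by
  classical
  set W := Submodule.span ℝ (Set.range fun j => Ψ (Y j)) with hW
  set M : Matrix ι ι ℝ := Matrix.of fun i j =>
    ⟪W.starProjection (Ψ (X i)), W.starProjection (Ψ (X j))⟫_ℝ / s with hMdef
  have hM : M.IsHermitian := by
    ext i j
    simp [hMdef, real_inner_comm]
  -- Rotating `X` by an eigenbasis of `M` keeps it white and makes the projections mutually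
  -- orthogonal.
  set u := hM.eigenvectorBasis with hu
  set X' : ι → E := fun i => ∑ k, u i k • X k with hX'
  have hdot : ∀ i j, ∑ k, u i k * u j k = if i = j then 1 else 0 := by
    intro i j
    have := orthonormal_iff_ite.1 u.orthonormal i j
    rw [← this, PiLp.inner_apply]
    exact Finset.sum_congr rfl fun k _ => by simp [mul_comm]
  have hΨX' : ∀ i, Ψ (X' i) = ∑ k, u i k • Ψ (X k) := fun i => by simp [hX']
  have hin : ∀ i j, ⟪Ψ (X' i), Ψ (X' j)⟫_ℝ = if i = j then s else 0 := by
    intro i j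
    have h1 : ∀ k l, ⟪Ψ (X k), Ψ (X l)⟫_ℝ = if k = l then s else 0 := by
      intro k l
      split_ifs with h
      · rw [← h, hX]
      · exact hXne k l h
    have h2 : ⟪Ψ (X' i), Ψ (X' j)⟫_ℝ = s * ∑ k, u i k * u j k := by
      simp [hΨX', sum_inner, inner_sum, inner_smul_left, inner_smul_right, h1, Finset.mul_sum]
      exact Finset.sum_congr rfl fun k _ => by ring
    rw [h2, hdot]
    split_ifs <;> simp
  have hPin : ∀ i j, ⟪W.starProjection (Ψ (X' i)), W.starProjection (Ψ (X' j))⟫_ℝ =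
      if i = j then s * hM.eigenvalues j else 0 := by
    intro i j
    have h1 : ∀ k l, ⟪W.starProjection (Ψ (X k)), W.starProjection (Ψ (X l))⟫_ℝ = s * M k l := by
      intro k l
      simp only [hMdef, Matrix.of_apply]
      field_simp
    have h2 : ∀ k, ∑ l, M k l * u j l = hM.eigenvalues j * u j k := by
      intro k
      have := congrFun (hM.mulVec_eigenvectorBasis j) k
      simpa [Matrix.mulVec, dotProduct] using this
    have h3 : ⟪W.starProjection (Ψ (X' i)), W.starProjection (Ψ (X' j))⟫_ℝ
        = ∑ k, s * (u i k * ∑ l, M k l * u j l) := by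
      simp only [hΨX', map_sum, map_smul, sum_inner, inner_sum, inner_smul_left, inner_smul_right,
        h1, Finset.mul_sum, conj_trivial]
      rw [Finset.sum_comm]
      refine Finset.sum_congr rfl fun k _ => Finset.sum_congr rfl fun l _ => ?_
      ring
    have h4 : ∑ k, s * (u i k * ∑ l, M k l * u j l)
        = s * hM.eigenvalues j * ∑ k, u i k * u j k := by
      rw [Finset.mul_sum]
      exact Finset.sum_congr rfl fun k _ => by rw [h2]; ring
    rw [h3, h4, hdot]
    split_ifs <;> simp
  have heig : ∀ i, 0 ≤ hM.eigenvalues i ∧ hM.eigenvalues i ≤ θ := by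
    intro i
    have h1 := hPin i i
    rw [if_pos rfl, real_inner_self_eq_norm_sq] at h1
    have h2 := hin i i
    rw [if_pos rfl, real_inner_self_eq_norm_sq] at h2
    have h3 := hP (Ψ (X' i)) (by
      rw [hΨX']
      exact Submodule.sum_mem _ fun k _ =>
        Submodule.smul_mem _ _ (Submodule.subset_span ⟨k, rfl⟩))
    rw [h1, h2] at h3
    have h4 : 0 ≤ s * hM.eigenvalues i := by rw [← h1]; positivity
    exact ⟨nonneg_of_mul_nonneg_right h4 hs, by nlinarith⟩
  -- The trace turns the sum of eigenvalues back into the energy of the original estimates.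
  have htr : ∑ i, ‖W.starProjection (Ψ (X i))‖ ^ 2 = s * ∑ i, hM.eigenvalues i := by
    have h1 := hM.trace_eq_sum_eigenvalues
    simp only [Matrix.trace, Matrix.diag, hMdef, Matrix.of_apply, real_inner_self_eq_norm_sq,
      RCLike.ofReal_real_eq_id, id] at h1
    rw [← h1, Finset.mul_sum]
    exact Finset.sum_congr rfl fun i _ => by field_simp
  have hinfo : (mutualInfo μ (fun ω i => B (X i) ω) (fun ω j => B (Y j) ω)).toReal
      = ∑ i, -Real.log (1 - hM.eigenvalues i) / 2 := by
    rw [← hB.toReal_mutualInfo_of_orthogonal (X := X') (Y := Y) hs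
      (fun i => (heig i).2.trans_lt hθ) (fun i => by rw [hin, if_pos rfl])
      (fun i j hij => by rw [hin, if_neg hij])
      (fun i => by rw [← real_inner_self_eq_norm_sq]; exact (hPin i i).trans (if_pos rfl))
      (fun i j hij => (hPin i j).trans (if_neg hij))]
    -- The rotated vector is an invertible function of `X`, so it carries the same information.
    rw [← mutualInfo_comp_measurableEquiv (hB.hasGaussianLaw_pi X).aemeasurable
      (hB.hasGaussianLaw_pi Y).aemeasurable
      (((MeasurableEquiv.toLp 2 (ι → ℝ)).trans u.repr.toHomeomorph.toMeasurableEquiv).trans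
        (MeasurableEquiv.toLp 2 (ι → ℝ)).symm) (MeasurableEquiv.refl _)]
    congr 2
    funext ω i
    change u.repr (WithLp.toLp 2 fun i => B (X i) ω) i = _
    rw [u.repr_apply_apply, PiLp.inner_apply]
    simp only [hX', map_sum, map_smul, Finset.sum_apply, Pi.smul_apply, smul_eq_mul]
    exact Finset.sum_congr rfl fun k _ => by simp [mul_comm]
  have hθ' : 0 < 1 - θ := by linarith
  have hb := fun i => log_one_sub_bounds (heig i).1 (heig i).2 hθ
  have e1 : s * (∑ i, hM.eigenvalues i) / (2 * s) = ∑ i, hM.eigenvalues i / 2 := by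
    rw [← Finset.sum_div]
    field_simp
  have e2 : s * (∑ i, hM.eigenvalues i) / (2 * s * (1 - θ))
      = ∑ i, hM.eigenvalues i / (1 - θ) / 2 := by
    rw [← Finset.sum_div, ← Finset.sum_div]
    field_simp
  rw [hinfo, htr, e1, e2]
  exact ⟨Finset.sum_le_sum fun i _ => div_le_div_of_nonneg_right (hb i).1 zero_le_two,
    Finset.sum_le_sum fun i _ => div_le_div_of_nonneg_right (hb i).2 zero_le_two⟩

end IsIsonormal

end Isonormal

/-! ### The channel in Hilbert space and the low SINR estimate. -/

section ChannelVector

/-- The convolution of the impulse response `h` with a sequence of vectors. -/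
def convVec {V : Type*} [AddCommMonoid V] [Module ℝ V] {Lh : ℕ} (h : Fin (Lh + 1) → ℝ)
    (u : ℤ → V) (k : ℤ) : V := ∑ i, h i • u (k - (i : ℕ))

/-- The channel output for sequences of vectors, with input `p • b (0, ·)`, interference
`q • b (1, ·)` and noise `r • b (2, ·)`. -/
def channelVec {V : Type*} [AddCommMonoid V] [Module ℝ V] {Lh : ℕ} (h : Fin (Lh + 1) → ℝ)
    (b : Fin 3 × ℤ → V) (p q r : ℝ) (k : ℤ) : V :=
  p • convVec h (fun j => b (0, j)) k + q • convVec h (fun j => b (1, j)) k + r • b (2, k)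

variable {H : Type*} [NormedAddCommGroup H] [InnerProductSpace ℝ H] {Lh : ℕ}
  {b : Fin 3 × ℤ → H}

lemma inner_basis_convVec (hb : Orthonormal ℝ b) (h : Fin (Lh + 1) → ℝ) (s t : Fin 3) (a k : ℤ) :
    ⟪b (s, a), convVec h (fun j => b (t, j)) k⟫_ℝ =
      if s = t then ∑ i : Fin (Lh + 1), (if a = k - (i : ℕ) then h i else 0) else 0 := by
  simp only [convVec, inner_sum, inner_smul_right, orthonormal_iff_ite.1 hb, Prod.mk.injEq]
  split_ifs with hst
  · exact Finset.sum_congr rfl fun i _ => by simp [hst]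
  · exact Finset.sum_eq_zero fun i _ => by simp [hst]

lemma inner_convVec_convVec (hb : Orthonormal ℝ b) (h : Fin (Lh + 1) → ℝ) (s t : Fin 3)
    (a k : ℤ) : ⟪convVec h (fun j => b (s, j)) a, convVec h (fun j => b (t, j)) k⟫_ℝ =
      if s = t then ∑ i : Fin (Lh + 1), ∑ j : Fin (Lh + 1),
        (if a - (i : ℕ) = k - (j : ℕ) then h i * h j else 0) else 0 := by
  rw [convVec, sum_inner]
  simp only [inner_smul_left, inner_basis_convVec hb, conj_trivial]
  split_ifs with hst
  · refine Finset.sum_congr rfl fun i _ => ?_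
    rw [Finset.mul_sum]
    exact Finset.sum_congr rfl fun j _ => by rw [mul_ite, mul_zero]
  · exact Finset.sum_eq_zero fun i _ => mul_zero _

lemma inner_basis_channelVec (hb : Orthonormal ℝ b) (h : Fin (Lh + 1) → ℝ) (p q r : ℝ)
    (a k : ℤ) : ⟪b (0, a), channelVec h b p q r k⟫_ℝ =
      p * ∑ i : Fin (Lh + 1), (if a = k - (i : ℕ) then h i else 0) := by
  simp [channelVec, inner_add_right, inner_smul_right, inner_basis_convVec hb,
    orthonormal_iff_ite.1 hb]

lemma inner_basis_channelVec_natCast (hb : Orthonormal ℝ b) (h : Fin (Lh + 1) → ℝ) (p q r : ℝ)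
    (i : Fin (Lh + 1)) : ⟪b (0, 0), channelVec h b p q r (i : ℕ)⟫_ℝ = p * h i := by
  rw [inner_basis_channelVec hb, Finset.sum_eq_single i]
  · simp
  · intro j _ hj
    rw [if_neg]
    intro h3
    exact hj (Fin.ext (by omega))
  · simp

lemma inner_channelVec_channelVec (hb : Orthonormal ℝ b) (h : Fin (Lh + 1) → ℝ) (p q r : ℝ)
    (a k : ℤ) : ⟪channelVec h b p q r a, channelVec h b p q r k⟫_ℝ =
      (p ^ 2 + q ^ 2) * (∑ i : Fin (Lh + 1), ∑ j : Fin (Lh + 1),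
        (if a - (i : ℕ) = k - (j : ℕ) then h i * h j else 0)) +
      r ^ 2 * (if a = k then 1 else 0) := by
  have h1 : ∀ s t a k, ⟪convVec h (fun j => b (s, j)) a, b (t, k)⟫_ℝ =
      if t = s then ∑ i : Fin (Lh + 1), (if k = a - (i : ℕ) then h i else 0) else 0 :=
    fun s t a k => by rw [real_inner_comm, inner_basis_convVec hb]
  simp only [channelVec, inner_add_right, inner_add_left, inner_smul_right, inner_smul_left,
    inner_convVec_convVec hb, inner_basis_convVec hb, h1, orthonormal_iff_ite.1 hb, conj_trivial]
  simp
  ring_nf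

lemma jointlyStationary_channelVec (hb : Orthonormal ℝ b) (h : Fin (Lh + 1) → ℝ) (p q r : ℝ) :
    JointlyStationary (fun k => p • b (0, k)) (channelVec h b p q r) where
  norm_left k := by simp [norm_smul, hb.1]
  inner_left_right a k t := by
    have h1 : ∀ i : Fin (Lh + 1), a + t = k + t - (i : ℕ) ↔ a = k - (i : ℕ) := fun i => by omega
    simp only [inner_smul_left, inner_basis_channelVec hb, h1]
  inner_right_right a k t := by
    have h1 : ∀ i j : Fin (Lh + 1),
        a + t - (i : ℕ) = k + t - (j : ℕ) ↔ a - (i : ℕ) = k - (j : ℕ) := fun i j => by omega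
    simp only [inner_channelVec_channelVec hb, h1, add_left_inj]

lemma norm_sq_sum_basis (hb : Orthonormal ℝ b) (t : Fin 3) (d : ℤ) (S : Finset ℤ) (c : ℤ → ℝ) :
    ‖∑ j ∈ S, c j • b (t, j - d)‖ ^ 2 = ∑ j ∈ S, c j ^ 2 := by
  have hc : Orthonormal ℝ fun j : ℤ => b (t, j - d) :=
    hb.comp (fun j : ℤ => (t, j - d)) fun i j hij => by simpa using hij
  rw [← real_inner_self_eq_norm_sq, hc.inner_sum]
  exact Finset.sum_congr rfl fun j _ => by simp [sq]

/-- Triangle inequality over the taps; each tap contributes a shifted orthonormal combination. -/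
lemma norm_sq_sum_convVec_le (hb : Orthonormal ℝ b) (h : Fin (Lh + 1) → ℝ) (t : Fin 3)
    (S : Finset ℤ) (c : ℤ → ℝ) :
    ‖∑ j ∈ S, c j • convVec h (fun k => b (t, k)) j‖ ^ 2 ≤
      (∑ i, |h i|) ^ 2 * ∑ j ∈ S, c j ^ 2 := by
  have h1 : ∑ j ∈ S, c j • convVec h (fun k => b (t, k)) j =
      ∑ i, h i • ∑ j ∈ S, c j • b (t, j - (i : ℕ)) := by
    simp only [convVec, Finset.smul_sum]
    rw [Finset.sum_comm]
    exact Finset.sum_congr rfl fun i _ => Finset.sum_congr rfl fun j _ => smul_comm _ _ _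
  have h2 : ∀ i : Fin (Lh + 1), ‖∑ j ∈ S, c j • b (t, j - (i : ℕ))‖ = √(∑ j ∈ S, c j ^ 2) :=
    fun i => by rw [← norm_sq_sum_basis hb t (i : ℕ) S c, Real.sqrt_sq (norm_nonneg _)]
  have h3 : ‖∑ j ∈ S, c j • convVec h (fun k => b (t, k)) j‖ ≤
      (∑ i, |h i|) * √(∑ j ∈ S, c j ^ 2) := by
    rw [h1, Finset.sum_mul]
    refine (norm_sum_le _ _).trans (Finset.sum_le_sum fun i _ => ?_)
    rw [norm_smul, h2, Real.norm_eq_abs]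
  calc _ ≤ ((∑ i, |h i|) * √(∑ j ∈ S, c j ^ 2)) ^ 2 := by gcongr
    _ = _ := by rw [mul_pow, Real.sq_sqrt (Finset.sum_nonneg fun _ _ => sq_nonneg _)]

/-- The three sources are orthogonal, and input and interference pass through the same convolution,
so the input copy accounts for both. -/
lemma norm_sq_sum_channelVec (hb : Orthonormal ℝ b) (h : Fin (Lh + 1) → ℝ) (p q r : ℝ)
    (S : Finset ℤ) (c : ℤ → ℝ) :
    ‖∑ j ∈ S, c j • channelVec h b p q r j‖ ^ 2 =
      (p ^ 2 + q ^ 2) * ‖∑ j ∈ S, c j • convVec h (fun k => b (0, k)) j‖ ^ 2 +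
        r ^ 2 * ∑ j ∈ S, c j ^ 2 := by
  have hC : ∑ j ∈ S, c j ^ 2 = ∑ i ∈ S, c i * ∑ j ∈ S, c j * (if i = j then 1 else 0) := by
    refine Finset.sum_congr rfl fun i hi => ?_
    simp [hi, sq]
  rw [hC]
  simp only [← real_inner_self_eq_norm_sq, sum_inner, inner_sum, inner_smul_left, inner_smul_right,
    inner_channelVec_channelVec hb, inner_convVec_convVec hb, conj_trivial, if_true,
    Finset.mul_sum, mul_add, Finset.sum_add_distrib]
  congr 1
  · refine Finset.sum_congr rfl fun i _ => Finset.sum_congr rfl fun j _ =>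
      Finset.sum_congr rfl fun k _ => Finset.sum_congr rfl fun l _ => ?_
    ring
  · refine Finset.sum_congr rfl fun i _ => Finset.sum_congr rfl fun j _ => ?_
    simp only [eq_comm (a := j)]
    ring

lemma norm_sq_sum_channelVec_le (hb : Orthonormal ℝ b) (h : Fin (Lh + 1) → ℝ) (p q r : ℝ)
    (S : Finset ℤ) (c : ℤ → ℝ) :
    ‖∑ j ∈ S, c j • channelVec h b p q r j‖ ^ 2 ≤
      ((p ^ 2 + q ^ 2) * (∑ i, |h i|) ^ 2 + r ^ 2) * ∑ j ∈ S, c j ^ 2 := by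
  have := norm_sq_sum_convVec_le hb h 0 S c
  rw [norm_sq_sum_channelVec hb]
  calc _ ≤ (p ^ 2 + q ^ 2) * ((∑ i, |h i|) ^ 2 * ∑ j ∈ S, c j ^ 2) +
        r ^ 2 * ∑ j ∈ S, c j ^ 2 := by gcongr
    _ = _ := by ring

/-- The fraction of the energy of the input that is captured by the channel output is at most `θ`
when the signal to interference and noise ratio is small. -/
lemma norm_sq_starProjection_le_of_channelVec (hb : Orthonormal ℝ b) (h : Fin (Lh + 1) → ℝ)
    {p q r θ : ℝ} (hθ : 0 ≤ θ)
    (hsinr : p ^ 2 * (1 + ∑ i, |h i|) ^ 2 ≤ θ * (q ^ 2 + r ^ 2))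
    (W : Submodule ℝ H) [W.HasOrthogonalProjection]
    (hW : W ≤ Submodule.span ℝ (Set.range (channelVec h b p q r))) {e : H}
    (he : e ∈ Submodule.span ℝ (Set.range fun k => b (0, k))) :
    ‖W.starProjection e‖ ^ 2 ≤ θ * ‖e‖ ^ 2 := by
  obtain ⟨c, hc⟩ := Finsupp.mem_span_range_iff_exists_finsupp.1
    (hW (W.starProjection_apply_mem e))
  set f := W.starProjection e with hf
  set A := ∑ j ∈ c.support, c j • convVec h (fun k => b (0, k)) j with hA
  set κ := 1 + ∑ i, |h i| with hκ
  have hκ0 : 0 ≤ ∑ i, |h i| := Finset.sum_nonneg fun _ _ => abs_nonneg _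
  have hκ1 : 1 ≤ κ := by rw [hκ]; linarith
  have hff : ‖f‖ ^ 2 = ⟪e, f⟫_ℝ := by
    rw [← real_inner_self_eq_norm_sq, real_inner_comm f e,
      IsIsonormal.inner_starProjection_left W e e]
  -- Input vectors see only the input part `p • A` of the estimate `f`.
  have horth : ∀ e' ∈ Submodule.span ℝ (Set.range fun k => b (0, k)),
      ⟪e', f⟫_ℝ = p * ⟪e', A⟫_ℝ := by
    intro e' he'
    induction he' using Submodule.span_induction with
    | mem x hx =>
      obtain ⟨k, rfl⟩ := hx
      rw [← hc, hA, Finsupp.sum]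
      simp only [inner_sum, inner_smul_right, inner_basis_channelVec hb, inner_basis_convVec hb,
        if_true, Finset.mul_sum]
      exact Finset.sum_congr rfl fun i _ => Finset.sum_congr rfl fun j _ => by ring
    | zero => simp
    | add x y _ _ hx hy => rw [inner_add_left, inner_add_left, hx, hy, mul_add]
    | smul a x _ hx => rw [inner_smul_left, inner_smul_left, hx]; simp; ring
  have henergy : ‖f‖ ^ 2 = (p ^ 2 + q ^ 2) * ‖A‖ ^ 2 + r ^ 2 * ∑ j ∈ c.support, c j ^ 2 := by
    rw [← hc]
    exact norm_sq_sum_channelVec hb h p q r c.support c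
  have hAC : ‖A‖ ^ 2 ≤ κ ^ 2 * ∑ j ∈ c.support, c j ^ 2 :=
    (norm_sq_sum_convVec_le hb h 0 c.support c).trans <| by
      have : (0 : ℝ) ≤ ∑ j ∈ c.support, c j ^ 2 := Finset.sum_nonneg fun _ _ => sq_nonneg _
      gcongr
      rw [hκ]; linarith
  have hpA : p ^ 2 * ‖A‖ ^ 2 ≤ θ * ‖f‖ ^ 2 := by
    have hκ2 : 1 ≤ κ ^ 2 := one_le_pow₀ hκ1
    set C := ∑ j ∈ c.support, c j ^ 2
    -- The factor `κ ^ 2` serves both disturbances: the `q` part needs `1 ≤ κ ^ 2`, which the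
    -- summand 1 in `κ` secures, and the `r` part needs `hAC`.
    have h1 : κ ^ 2 * (p ^ 2 * ‖A‖ ^ 2) ≤ κ ^ 2 * (θ * ‖f‖ ^ 2) := by
      calc κ ^ 2 * (p ^ 2 * ‖A‖ ^ 2) = p ^ 2 * κ ^ 2 * ‖A‖ ^ 2 := by ring
        _ ≤ θ * (q ^ 2 + r ^ 2) * ‖A‖ ^ 2 := by gcongr
        _ = θ * (1 * (q ^ 2 * ‖A‖ ^ 2) + r ^ 2 * ‖A‖ ^ 2) := by ring
        _ ≤ θ * (κ ^ 2 * (q ^ 2 * ‖A‖ ^ 2) + r ^ 2 * (κ ^ 2 * C)) := by gcongr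
        _ = κ ^ 2 * (θ * (q ^ 2 * ‖A‖ ^ 2 + r ^ 2 * C)) := by ring
        _ ≤ κ ^ 2 * (θ * ‖f‖ ^ 2) := by
          rw [henergy]
          gcongr
          nlinarith [sq_nonneg (p * ‖A‖)]
    exact le_of_mul_le_mul_left h1 (by positivity)
  -- Cauchy–Schwarz in `‖f‖² = p ⟪e, A⟫`; one factor `‖f‖²` is cancelled afterwards.
  have h4 : (‖f‖ ^ 2) ^ 2 ≤ ‖e‖ ^ 2 * (θ * ‖f‖ ^ 2) := by
    rw [horth e he] at hff
    calc (‖f‖ ^ 2) ^ 2 = p ^ 2 * ⟪e, A⟫_ℝ ^ 2 := by rw [hff]; ring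
      _ ≤ p ^ 2 * (‖e‖ * ‖A‖) ^ 2 := by
        have := sq_le_sq' (neg_le_of_abs_le (abs_real_inner_le_norm e A))
          (le_of_abs_le (abs_real_inner_le_norm e A))
        gcongr
      _ = ‖e‖ ^ 2 * (p ^ 2 * ‖A‖ ^ 2) := by ring
      _ ≤ _ := by gcongr
  rcases (sq_nonneg ‖f‖).eq_or_lt with h0 | h0
  · rw [← h0]; positivity
  · have : ‖f‖ ^ 2 * ‖f‖ ^ 2 ≤ ‖f‖ ^ 2 * (θ * ‖e‖ ^ 2) := by linarith
    exact le_of_mul_le_mul_left this h0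

/-- Pairing a vanishing combination with the inputs shows that its coefficients solve a recurrence;
being finitely supported, they vanish. This works without noise too, and makes the covariance matrix
of a window invertible. -/
lemma linearIndependent_channelVec (hb : Orthonormal ℝ b) {h : Fin (Lh + 1) → ℝ} (hh : h ≠ 0)
    {p : ℝ} (hp : p ≠ 0) (q r : ℝ) : LinearIndependent ℝ (channelVec h b p q r) := by
  rw [linearIndependent_iff]
  intro c hc
  have hrec : ∀ a : ℤ, ∑ i : Fin (Lh + 1), h i * c (a + (i : ℕ)) = 0 := by
    intro a
    have h1 : ⟪b (0, a), Finsupp.linearCombination ℝ (channelVec h b p q r) c⟫_ℝ = 0 := by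
      rw [hc, inner_zero_right]
    rw [Finsupp.linearCombination_apply, Finsupp.sum, inner_sum] at h1
    simp only [inner_smul_right, inner_basis_channelVec hb] at h1
    have h2 : ∑ j ∈ c.support, c j * (p * ∑ i : Fin (Lh + 1), if a = j - (i : ℕ) then h i else 0)
        = p * ∑ i : Fin (Lh + 1), h i * c (a + (i : ℕ)) := by
      simp only [Finset.mul_sum]
      rw [Finset.sum_comm]
      refine Finset.sum_congr rfl fun i _ => ?_
      rw [Finset.sum_eq_single (a + (i : ℕ))]
      · rw [if_pos (by omega)]; ring
      · intro j _ hj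
        rw [if_neg (by omega)]; ring
      · intro hj
        rw [Finsupp.notMem_support_iff.1 hj, zero_mul]
    rw [h2] at h1
    exact (mul_eq_zero.1 h1).resolve_left hp
  have hlim : Tendsto c cofinite (𝓝 0) := by
    refine tendsto_const_nhds.congr' ?_
    filter_upwards [c.support.finite_toSet.compl_mem_cofinite] with j hj
    simpa [eq_comm] using hj
  exact DFunLike.coe_injective (eq_zero_of_recurrence hh hrec hlim)

/-- Zero energy would make `x 0` orthogonal to every output, but its inner product with output `i`
is `p ^ 2 * h i`. -/
lemma limitEnergy_channelVec_pos [CompleteSpace H] (hb : Orthonormal ℝ b) {h : Fin (Lh + 1) → ℝ}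
    (hh : h ≠ 0) {p : ℝ} (hp : p ≠ 0) (q r : ℝ) :
    0 < JointlyStationary.limitEnergy (fun k => p • b (0, k)) (channelVec h b p q r) := by
  rw [JointlyStationary.limitEnergy]
  set K := (Submodule.span ℝ (Set.range (channelVec h b p q r))).topologicalClosure
  refine lt_of_le_of_ne (sq_nonneg _) fun h0 => ?_
  obtain ⟨i, hi⟩ := Function.ne_iff.1 hh
  have h1 : K.starProjection (p • b (0, 0)) = 0 := by
    simpa using h0.symm
  have h2 := (K.mem_orthogonal' _).1 (K.starProjection_apply_eq_zero_iff.1 h1)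
    (channelVec h b p q r (i : ℕ))
    (Submodule.le_topologicalClosure _ (Submodule.subset_span ⟨_, rfl⟩))
  rw [inner_smul_left, inner_basis_channelVec_natCast hb] at h2
  simp [hp] at h2
  exact hi h2

end ChannelVector

/-! ### Independent Gaussian sources. -/

section Source

variable {Ω : Type*} [MeasurableSpace Ω] {μ : Measure Ω}

lemma isGaussianProcess_of_iIndepFun {T : Type*} {ξ : T → Ω → ℝ}
    (hξ : ∀ t, HasGaussianLaw (ξ t) μ) (hind : iIndepFun ξ μ) : IsGaussianProcess ξ μ where
  hasGaussianLaw I := iIndepFun.hasGaussianLaw (X := fun (i : I) => ξ i) (fun i => hξ i)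
    (hind.precomp Subtype.val_injective)

/-- Independent centred Gaussian variables, with arbitrary variances, form an isonormal family. -/
lemma isIsonormal_linearCombination [IsProbabilityMeasure μ] {T H : Type*} [NormedAddCommGroup H]
    [InnerProductSpace ℝ H] {b : T → H} (hb : Orthonormal ℝ b) {ξ : T → Ω → ℝ} {v : T → ℝ≥0}
    (hξ : ∀ t, HasLaw (ξ t) (gaussianReal 0 (v t)) μ) (hind : iIndepFun ξ μ) :
    IsIsonormal μ (Finsupp.linearCombination ℝ ξ)
      (Finsupp.linearCombination ℝ fun t => √(v t : ℝ) • b t) := by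
  classical
  have hG := isGaussianProcess_of_iIndepFun (fun t => (hξ t).hasGaussianLaw) hind
  have hB : ∀ (c : T →₀ ℝ) ω, Finsupp.linearCombination ℝ ξ c ω =
      ∑ t ∈ c.support, c t * ξ t ω := by
    intro c ω
    simp [Finsupp.linearCombination_apply, Finsupp.sum, Finset.sum_apply]
  have hint : ∀ t, Integrable (ξ t) μ := fun t => (hξ t).hasGaussianLaw.integrable
  have hmean : ∀ t, ∫ ω, ξ t ω ∂μ = 0 := fun t => by
    rw [(hξ t).integral_eq, integral_id_gaussianReal]
  have hmul : ∀ t u, Integrable (fun ω => ξ t ω * ξ u ω) μ := fun t u =>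
    (hξ t).hasGaussianLaw.memLp_two.integrable_mul (hξ u).hasGaussianLaw.memLp_two
  have hcov : ∀ t u, ∫ ω, ξ t ω * ξ u ω ∂μ = if t = u then (v t : ℝ) else 0 := by
    intro t u
    split_ifs with h
    · subst h
      rw [← (integrable_sq_and_integral_sq_of_hasLaw_gaussianReal (hξ t)).2]
      simp only [sq]
    · have := (hind.indepFun h).integral_fun_mul_eq_mul_integral
        (hint t).aestronglyMeasurable (hint u).aestronglyMeasurable
      rw [this, hmean, zero_mul]
  refine ⟨hG.of_isGaussianProcess fun c => ⟨c.support,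
    ∑ i : c.support, c i • ContinuousLinearMap.proj i, fun ω => ?_⟩, fun c => ?_, fun c d => ?_⟩
  · rw [hB, ← Finset.sum_coe_sort]
    simp
  · simp only [hB]
    rw [integral_finsetSum _ fun t _ => (hint t).const_mul _]
    exact Finset.sum_eq_zero fun t _ => by rw [integral_const_mul, hmean, mul_zero]
  · have hexp : ∀ ω, Finsupp.linearCombination ℝ ξ c ω * Finsupp.linearCombination ℝ ξ d ω =
        ∑ t ∈ c.support, ∑ u ∈ d.support, c t * d u * (ξ t ω * ξ u ω) := by
      intro ω
      rw [hB, hB, Finset.sum_mul_sum]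
      exact Finset.sum_congr rfl fun t _ => Finset.sum_congr rfl fun u _ => by ring
    simp only [hexp]
    rw [integral_finsetSum _ fun t _ => integrable_finsetSum _ fun u _ => (hmul t u).const_mul _]
    simp only [Finsupp.linearCombination_apply, Finsupp.sum]
    rw [sum_inner]
    refine Finset.sum_congr rfl fun t _ => ?_
    rw [inner_sum, integral_finsetSum _ fun u _ => (hmul t u).const_mul _]
    refine Finset.sum_congr rfl fun u _ => ?_
    rw [integral_const_mul, hcov]
    simp only [inner_smul_left, inner_smul_right, orthonormal_iff_ite.1 hb, conj_trivial]
    split_ifs with h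
    · subst h
      have := Real.mul_self_sqrt (v t).coe_nonneg
      linear_combination (-(c t) * d t) * this
    · simp

end Source

/-! ### The LMMSE filter as an orthogonal projection. -/

section LMMSE

variable {Ω E H : Type*} [MeasurableSpace Ω] [AddCommGroup E] [Module ℝ E]
  [NormedAddCommGroup H] [InnerProductSpace ℝ H] {μ : Measure Ω}
  {B : E →ₗ[ℝ] (Ω → ℝ)} {Ψ : E →ₗ[ℝ] H} {X Y : ℤ → E}

/-- The LMMSE taps do not depend on time, and the LMMSE output is an orthogonal projection. -/
lemma exists_lmmseTaps (hB : IsIsonormal μ B Ψ)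
    (hXY : JointlyStationary (fun k => Ψ (X k)) (fun k => Ψ (Y k)))
    (hY : LinearIndependent ℝ fun k => Ψ (Y k)) (L : ℕ) :
    ∃ g : Fin (2 * L + 1) → ℝ,
      (∀ k, lmmseTaps μ L (fun k => B (X k)) (fun k => B (Y k)) k = g) ∧
      ∀ k, ∑ i : Fin (2 * L + 1), g i • Ψ (Y (k - (L : ℤ) + (i : ℕ))) =
        (Submodule.span ℝ (Set.range fun i : Fin (2 * L + 1) =>
          Ψ (Y (k - (L : ℤ) + (i : ℕ))))).starProjection (Ψ (X k)) := by
  set R : Matrix (Fin (2 * L + 1)) (Fin (2 * L + 1)) ℝ :=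
    Matrix.gram ℝ fun i : Fin (2 * L + 1) => Ψ (Y (0 - (L : ℤ) + (i : ℕ))) with hR
  set c : Fin (2 * L + 1) → ℝ := fun i => ⟪Ψ (X 0), Ψ (Y (0 - (L : ℤ) + (i : ℕ)))⟫_ℝ with hc
  have hli : LinearIndependent ℝ fun i : Fin (2 * L + 1) => Ψ (Y (0 - (L : ℤ) + (i : ℕ))) :=
    hY.comp (fun i : Fin (2 * L + 1) => 0 - (L : ℤ) + (i : ℕ)) fun i j hij => Fin.ext (by
      simp only at hij
      omega)
  have hdet : IsUnit R.det := (Matrix.isUnit_iff_isUnit_det R).1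
    (Matrix.posDef_gram_of_linearIndependent hli).isUnit
  have hRk : ∀ (k : ℤ) (i j : Fin (2 * L + 1)),
      ⟪Ψ (Y (k - (L : ℤ) + (i : ℕ))), Ψ (Y (k - (L : ℤ) + (j : ℕ)))⟫_ℝ = R i j := by
    intro k i j
    have := hXY.inner_right_right (0 - (L : ℤ) + (i : ℕ)) (0 - (L : ℤ) + (j : ℕ)) k
    rw [hR, Matrix.gram_apply, ← this]
    congr 3 <;> ring
  have hck : ∀ (k : ℤ) (i : Fin (2 * L + 1)),
      ⟪Ψ (X k), Ψ (Y (k - (L : ℤ) + (i : ℕ)))⟫_ℝ = c i := by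
    intro k i
    have := hXY.inner_left_right 0 (0 - (L : ℤ) + (i : ℕ)) k
    refine Eq.trans ?_ this
    congr 3 <;> ring
  refine ⟨R⁻¹ *ᵥ c, fun k => ?_, fun k => ?_⟩
  · rw [lmmseTaps]
    congr 2
    · ext i j
      simp only [Matrix.of_apply, window]
      rw [hB.integral_mul]
      exact hRk k i j
    · funext i
      simp only [window]
      rw [hB.integral_mul, real_inner_comm]
      exact hck k i
  -- The normal equations `R g = c` say that the error is orthogonal to the window.
  · symm
    refine Submodule.eq_starProjection_of_mem_of_inner_eq_zero
      (Submodule.sum_mem _ fun i _ => Submodule.smul_mem _ _ (Submodule.subset_span ⟨i, rfl⟩))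
      fun w hw => ?_
    induction hw using Submodule.span_induction with
    | mem w hw =>
      obtain ⟨i, rfl⟩ := hw
      have h1 : (R *ᵥ (R⁻¹ *ᵥ c)) i = c i := by
        rw [Matrix.mulVec_mulVec, Matrix.mul_nonsing_inv _ hdet, Matrix.one_mulVec]
      simp only [inner_sub_left, sum_inner, inner_smul_left, hRk, hck, conj_trivial]
      rw [← h1, Matrix.mulVec, dotProduct, sub_eq_zero]
      refine Finset.sum_congr rfl fun j _ => ?_
      rw [mul_comm, ← hRk 0 i j, real_inner_comm, hRk]
    | zero => simp
    | add a b _ _ ha hb => rw [inner_add_right, ha, hb, add_zero]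
    | smul a b _ hb => rw [inner_smul_right, hb, mul_zero]

end LMMSE

/-! ### Information bounds for blocks and for single symbols. -/

section Bounds

variable {Ω E H : Type*} [MeasurableSpace Ω] [AddCommGroup E] [Module ℝ E]
  [NormedAddCommGroup H] [InnerProductSpace ℝ H] {μ : Measure Ω} [IsProbabilityMeasure μ]
  {B : E →ₗ[ℝ] (Ω → ℝ)} {Ψ : E →ₗ[ℝ] H} {X U : ℤ → E} {s t : ℝ}

/-- Two-sided bound on the information that a block of a stationary sequence carries about a block
of a white one. -/
lemma eventually_mutualInfo_block_bounds [CompleteSpace H] (hB : IsIsonormal μ B Ψ)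
    (hXU : JointlyStationary (fun k => Ψ (X k)) (fun k => Ψ (U k)))
    (hs : 0 < s) (ht0 : 0 < t) (ht : t < 1) (hX : ∀ i, ⟪Ψ (X i), Ψ (X i)⟫_ℝ = s)
    (hXne : ∀ i j, i ≠ j → ⟪Ψ (X i), Ψ (X j)⟫_ℝ = 0)
    (hpos : 0 < JointlyStationary.limitEnergy (fun k => Ψ (X k)) (fun k => Ψ (U k)))
    (hP : ∀ (W : Submodule ℝ H) [W.HasOrthogonalProjection],
      W ≤ Submodule.span ℝ (Set.range fun k => Ψ (U k)) →
      ∀ e ∈ Submodule.span ℝ (Set.range fun k => Ψ (X k)),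
      ‖W.starProjection e‖ ^ 2 ≤ t * ‖e‖ ^ 2) :
    ∀ᶠ N : ℕ in atTop,
      N * JointlyStationary.limitEnergy (fun k => Ψ (X k)) (fun k => Ψ (U k)) / (2 * s) * (1 - t)
        ≤ (mutualInfo μ (block (fun k => B (X k)) N) (block (fun k => B (U k)) N)).toReal ∧
      (mutualInfo μ (block (fun k => B (X k)) N) (block (fun k => B (U k)) N)).toReal ≤
      N * JointlyStationary.limitEnergy (fun k => Ψ (X k)) (fun k => Ψ (U k)) / (2 * s)
        / (1 - t) := by
  set ρ := JointlyStationary.limitEnergy (fun k => Ψ (X k)) (fun k => Ψ (U k)) with hρ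
  -- With `η = ρ * t` the edge loss costs a factor `1 - t`, as the logarithm does in the upper
  -- bound.
  filter_upwards [hXU.eventually_le_sum_norm_sq_starProjection (mul_pos hpos ht0)] with N hN
  have hN' := hXU.sum_norm_sq_starProjection_le N
  have hbd := hB.toReal_mutualInfo_bounds (X := fun k : Fin N => X ((k : ℕ) : ℤ))
    (Y := fun k : Fin N => U ((k : ℕ) : ℤ)) hs ht (fun i => hX _)
    (fun i j hij => hXne _ _ fun h => hij (Fin.ext (by exact_mod_cast h)))
    (fun e he => hP _ (Submodule.span_mono (by rintro _ ⟨j, rfl⟩; exact ⟨_, rfl⟩)) e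
      (Submodule.span_mono (by rintro _ ⟨j, rfl⟩; exact ⟨_, rfl⟩) he))
  have h1t : 0 < 1 - t := by linarith
  refine ⟨le_trans ?_ hbd.1, hbd.2.trans ?_⟩
  · calc N * ρ / (2 * s) * (1 - t) = N * (ρ - ρ * t) / (2 * s) := by ring
      _ ≤ _ := by gcongr
  · rw [div_div]
    gcongr

/-- Two-sided bound on the information that a linear estimate carries about a variable. -/
lemma mutualInfo_projection_bounds (hB : IsIsonormal μ B Ψ) {X V : E}
    (hs : 0 < s) (ht : t < 1) (hX : ⟪Ψ X, Ψ X⟫_ℝ = s) (W : Submodule ℝ H)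
    [W.HasOrthogonalProjection] (hV : Ψ V = W.starProjection (Ψ X))
    (hP : ∀ (W' : Submodule ℝ H) [W'.HasOrthogonalProjection], W' ≤ W →
      ∀ e ∈ Submodule.span ℝ {Ψ X}, ‖W'.starProjection e‖ ^ 2 ≤ t * ‖e‖ ^ 2) :
    ‖W.starProjection (Ψ X)‖ ^ 2 / (2 * s) ≤ (mutualInfo μ (B X) (B V)).toReal ∧
      (mutualInfo μ (B X) (B V)).toReal ≤
        ‖W.starProjection (Ψ X)‖ ^ 2 / (2 * s * (1 - t)) := by
  have hrange : Set.range (fun _ : Unit => Ψ V) = {Ψ V} := Set.range_const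
  have hle : Submodule.span ℝ (Set.range fun _ : Unit => Ψ V) ≤ W := by
    rw [hrange, Submodule.span_singleton_le_iff_mem, hV]
    exact W.starProjection_apply_mem _
  -- The estimation error is orthogonal to `W`, hence to the line of `V`: the estimate alone
  -- captures as much energy as the whole window.
  have hproj : (Submodule.span ℝ (Set.range fun _ : Unit => Ψ V)).starProjection (Ψ X) =
      W.starProjection (Ψ X) :=
    Submodule.eq_starProjection_of_mem_of_inner_eq_zero
      (by rw [← hV]; exact Submodule.subset_span ⟨(), rfl⟩)
      fun w hw => W.starProjection_inner_eq_zero _ _ (hle hw)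
  have hbd := hB.toReal_mutualInfo_bounds (X := fun _ : Unit => X) (Y := fun _ : Unit => V) hs ht
    (fun _ => hX) (fun i j hij => (hij rfl).elim)
    (fun e he => hP _ hle e (by rwa [Set.range_const] at he))
  have hinfo := mutualInfo_comp_measurableEquiv (μ := μ) (hB.aemeasurable X) (hB.aemeasurable V)
    (MeasurableEquiv.funUnique Unit ℝ).symm (MeasurableEquiv.funUnique Unit ℝ).symm
  simp only [hproj, Finset.univ_unique, Finset.sum_const, Finset.card_singleton, one_smul] at hbd
  rw [← hinfo]
  exact hbd

end Bounds

/-! ### Comparison of the ratios and the main theorem. -/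

lemma abs_div_sub_one_lt {a b m t ε : ℝ} (hm : 0 < m) (ht0 : 0 < t) (ht : t ≤ 1 / 4)
    (htε : t ≤ ε / 8) (ha1 : m * (1 - t) ≤ a) (ha2 : a ≤ m / (1 - t)) (hb1 : m * (1 - t) ≤ b)
    (hb2 : b ≤ m / (1 - t)) : |a / b - 1| < ε := by
  have h1 : 0 < 1 - t := by linarith
  have hb : 0 < b := (mul_pos hm h1).trans_le hb1
  rw [le_div_iff₀ h1] at ha2 hb2
  have e1 : a < b * (1 + ε) := by
    -- The ratio lies between `(1 - t) ^ 2` and `(1 - t)⁻¹ ^ 2`; `8 * t ≤ ε` and `t ≤ 1 / 4` keep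
    -- both within `ε` of 1.
    have h2 : a * (1 - t) ^ 2 ≤ b := by nlinarith
    have h3 : 1 < (1 + ε) * (1 - t) ^ 2 := by
      nlinarith [mul_pos ht0 h1, mul_pos ht0 ht0, mul_nonneg (by linarith : 0 ≤ ε - 8 * t)
        (sq_nonneg (1 - t))]
    have h4 : a * (1 - t) ^ 2 < b * (1 + ε) * (1 - t) ^ 2 := by nlinarith
    exact lt_of_mul_lt_mul_right h4 (sq_nonneg _)
  have e2 : b * (1 - ε) < a := by
    have h2 : b * (1 - t) ^ 2 ≤ a := by nlinarith
    nlinarith [sq_nonneg t, mul_pos hb ht0, mul_nonneg hb.le (sq_nonneg t)]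
  rw [abs_lt]
  constructor
  · have : 1 - ε < a / b := by rw [lt_div_iff₀ hb]; linarith
    linarith
  · have : a / b < 1 + ε := by rw [div_lt_iff₀ hb]; linarith
    linarith

lemma orthonormal_lp_single (T : Type*) [DecidableEq T] :
    Orthonormal ℝ fun p : T => (lp.single 2 p (1 : ℝ) : lp (fun _ : T => ℝ) 2) := by
  rw [orthonormal_iff_ite]
  intro i j
  rw [lp.inner_single_left]
  simp [lp.single_apply, Pi.single_apply]

lemma map_channelVec {V V' : Type*} [AddCommMonoid V] [Module ℝ V] [AddCommMonoid V']
    [Module ℝ V'] (Φ : V →ₗ[ℝ] V') {Lh : ℕ} (h : Fin (Lh + 1) → ℝ) (b : Fin 3 × ℤ → V)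
    (p q r : ℝ) (k : ℤ) :
    Φ (channelVec h b p q r k) = channelVec h (fun j => Φ (b j)) p q r k := by
  simp [channelVec, convVec]

lemma channelVec_smul {V : Type*} [AddCommMonoid V] [Module ℝ V] {Lh : ℕ}
    (h : Fin (Lh + 1) → ℝ) (b : Fin 3 × ℤ → V) (a : Fin 3 → ℝ) (k : ℤ) :
    channelVec h (fun j => a j.1 • b j) 1 1 1 k = channelVec h b (a 0) (a 1) (a 2) k := by
  simp [channelVec, convVec, Finset.smul_sum, smul_comm (a _)]

lemma channelOutput_eq_channelVec {Ω : Type*} {Lh : ℕ} (h : Fin (Lh + 1) → ℝ)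
    (x z w : ℤ → Ω → ℝ) :
    channelOutput h x z w = channelVec h (fun j => ![x, z, w] j.1 j.2) 1 1 1 := by
  funext k ω
  simp [channelOutput, channelVec, convVec, mul_add, Finset.sum_add_distrib]

end ISIChannel

theorem theorem1 {Lh : ℕ} (h : Fin (Lh + 1) → ℝ) (hh : h ≠ 0) (ε : ℝ) (hε : 0 < ε) :
    ∃ δ : ℝ, 0 < δ ∧
      ∀ (Ω : Type*) [MeasurableSpace Ω] (μ : Measure Ω) [IsProbabilityMeasure μ]
        (x z w : ℤ → Ω → ℝ) (vx vz vw : ℝ≥0),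
        ISIChannel.IsGaussianSource μ x z w vx vz vw →
        0 < vx → 0 < vz + vw → (vx : ℝ) / ((vz : ℝ) + (vw : ℝ)) < δ →
        (∀ L : ℕ, (∃ i : Fin (Lh + 1), (i : ℕ) ≤ L ∧ h i ≠ 0) →
          ∀ᶠ N : ℕ in atTop,
            |ISIChannel.blockRatio μ N x
                (ISIChannel.lmmseOutput μ L x (ISIChannel.channelOutput h x z w))
                (ISIChannel.channelOutput h x z w) - 1| < ε) ∧
        (∀ᶠ L : ℕ in atTop, ∀ᶠ N : ℕ in atTop,
            |ISIChannel.symbolRatio μ N x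
                (ISIChannel.lmmseOutput μ L x (ISIChannel.channelOutput h x z w))
                (ISIChannel.channelOutput h x z w) - 1| < ε) := by
  open ISIChannel in
  open scoped InnerProductSpace in
  classical
  set κ : ℝ := 1 + ∑ i, |h i| with hκ
  have hκ0 : 0 < κ := by
    have : 0 ≤ ∑ i, |h i| := Finset.sum_nonneg fun _ _ => abs_nonneg _
    rw [hκ]; linarith
  set t : ℝ := min (1 / 4) (ε / 8) with ht
  have ht0 : 0 < t := lt_min (by norm_num) (by linarith)
  have ht4 : t ≤ 1 / 4 := min_le_left _ _
  have htε : t ≤ ε / 8 := min_le_right _ _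
  have ht1 : t < 1 := by linarith
  -- This `δ` makes `vx * κ ^ 2 ≤ t * (vz + vw)`, the condition under which the captured fraction of
  -- energy is at most `t`.
  refine ⟨t / κ ^ 2, by positivity, ?_⟩
  intro Ω _ μ _ x z w vx vz vw hsrc hvx hvzw hsinr
  let H := lp (fun _ : Fin 3 × ℤ => ℝ) 2
  let b : Fin 3 × ℤ → H := fun j => lp.single 2 j (1 : ℝ)
  have hb : Orthonormal ℝ b := orthonormal_lp_single (Fin 3 × ℤ)
  let ξ : Fin 3 × ℤ → Ω → ℝ := fun j => ![x, z, w] j.1 j.2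
  let v : Fin 3 → ℝ≥0 := ![vx, vz, vw]
  let B : (Fin 3 × ℤ →₀ ℝ) →ₗ[ℝ] (Ω → ℝ) := Finsupp.linearCombination ℝ ξ
  -- Formal combinations of the sources map both to random variables and to vectors; the scaling by
  -- standard deviations allows zero variances.
  let Ψ : (Fin 3 × ℤ →₀ ℝ) →ₗ[ℝ] H := Finsupp.linearCombination ℝ fun j => √(v j.1 : ℝ) • b j
  have hB : IsIsonormal μ B Ψ := by
    refine isIsonormal_linearCombination hb (v := fun j => v j.1) (fun j => ?_) hsrc.indep
    obtain ⟨i, k⟩ := j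
    fin_cases i
    exacts [hsrc.law_x k, hsrc.law_z k, hsrc.law_w k]
  let X : ℤ → (Fin 3 × ℤ →₀ ℝ) := fun k => Finsupp.single (0, k) 1
  let Y : ℤ → (Fin 3 × ℤ →₀ ℝ) := channelVec h (fun j => Finsupp.single j 1) 1 1 1
  have hBX : (fun k => B (X k)) = x := by
    funext k
    simp [B, X, ξ]
  have hBY : (fun k => B (Y k)) = channelOutput h x z w := by
    rw [channelOutput_eq_channelVec]
    funext k
    have hsingle : (fun j : Fin 3 × ℤ => B (Finsupp.single j 1)) = ξ := by
      funext j
      simp [B]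
    have := map_channelVec B h (fun j => Finsupp.single j 1) 1 1 1 k
    rwa [hsingle] at this
  have hΨX : ∀ k, Ψ (X k) = √(vx : ℝ) • b (0, k) := fun k => by simp [Ψ, X, v]
  have hΨY : (fun k => Ψ (Y k)) = channelVec h b √(vx : ℝ) √(vz : ℝ) √(vw : ℝ) := by
    funext k
    have hsingle : (fun j : Fin 3 × ℤ => Ψ (Finsupp.single j 1)) =
        fun j => √(v j.1 : ℝ) • b j := by
      funext j
      simp [Ψ]
    have := map_channelVec Ψ h (fun j => Finsupp.single j 1) 1 1 1 k
    rw [hsingle] at this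
    exact this.trans <| channelVec_smul h b (fun i => √(v i : ℝ)) k
  have hvx' : (0 : ℝ) < vx := by exact_mod_cast hvx
  have hp : √(vx : ℝ) ≠ 0 := (Real.sqrt_pos.2 hvx').ne'
  have hst : JointlyStationary (fun k => Ψ (X k)) (fun k => Ψ (Y k)) := by
    rw [hΨY]
    simp only [hΨX]
    exact jointlyStationary_channelVec hb h _ _ _
  have hli : LinearIndependent ℝ fun k => Ψ (Y k) := by
    rw [hΨY]
    exact linearIndependent_channelVec hb hh hp _ _
  have hX : ∀ i, ⟪Ψ (X i), Ψ (X i)⟫_ℝ = vx := fun i => by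
    rw [hB.integral_mul .. |>.symm, ← (integrable_sq_and_integral_sq_of_hasLaw_gaussianReal
      (hsrc.law_x i)).2, ← hBX]
    simp only [sq]
  have hXne : ∀ i j, i ≠ j → ⟪Ψ (X i), Ψ (X j)⟫_ℝ = 0 := fun i j hij => by
    rw [hΨX, hΨX, inner_smul_left, inner_smul_right, orthonormal_iff_ite.1 hb]
    simp [hij]
  set ρ := JointlyStationary.limitEnergy (fun k => Ψ (X k)) (fun k => Ψ (Y k)) with hρ
  have hρ0 : 0 < ρ := by
    rw [hρ, hΨY]
    simp only [hΨX]
    exact limitEnergy_channelVec_pos hb hh hp _ _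
  have hspanX : Submodule.span ℝ (Set.range fun k => Ψ (X k)) ≤
      Submodule.span ℝ (Set.range fun k => b (0, k)) := by
    rw [Submodule.span_le]
    rintro _ ⟨k, rfl⟩
    simp only [hΨX]
    exact Submodule.smul_mem _ _ (Submodule.subset_span ⟨k, rfl⟩)
  have hP : ∀ (W : Submodule ℝ H) [W.HasOrthogonalProjection],
      W ≤ Submodule.span ℝ (Set.range fun k => Ψ (Y k)) →
      ∀ e ∈ Submodule.span ℝ (Set.range fun k => Ψ (X k)),
      ‖W.starProjection e‖ ^ 2 ≤ t * ‖e‖ ^ 2 := by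
    intro W _ hW e he
    rw [hΨY] at hW
    refine norm_sq_starProjection_le_of_channelVec hb h ht0.le ?_ W hW (hspanX he)
    have hpos : (0 : ℝ) < (vz : ℝ) + vw := by exact_mod_cast hvzw
    rw [Real.sq_sqrt vx.coe_nonneg, Real.sq_sqrt vz.coe_nonneg, Real.sq_sqrt vw.coe_nonneg]
    rw [div_lt_div_iff₀ hpos (by positivity)] at hsinr
    exact hsinr.le
  have hblock := eventually_mutualInfo_block_bounds hB hst hvx' ht0 ht1 hX hXne hρ0 hP
  rw [hBX, hBY, ← hρ] at hblock
  have hm : ∀ N : ℕ, 0 < N → 0 < N * ρ / (2 * vx) := fun N hN => by positivity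
  have hout : ∀ (L : ℕ) (g : Fin (2 * L + 1) → ℝ),
      (∀ k, lmmseTaps μ L x (channelOutput h x z w) k = g) →
      lmmseOutput μ L x (channelOutput h x z w) =
        fun k => B (∑ i : Fin (2 * L + 1), g i • Y (k - (L : ℤ) + (i : ℕ))) := by
    intro L g hg
    funext k ω
    rw [lmmseOutput, hg, ← hBY, map_sum]
    simp [window]
  refine ⟨fun L hL => ?_, ?_⟩
  · obtain ⟨g, hg, hgW⟩ := exists_lmmseTaps hB hst hli L
    rw [hBX, hBY] at hg
    -- With zero taps `x 0` would be orthogonal to its window, which contains output `i` at position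
    -- `L + i` because `i ≤ L`; this contradicts `h i ≠ 0`.
    have hg0 : g ≠ 0 := by
      rintro rfl
      obtain ⟨i, hiL, hi⟩ := hL
      have h1 := hgW 0
      simp only [Pi.zero_apply, zero_smul, Finset.sum_const_zero] at h1
      have h2 := (Submodule.mem_orthogonal' _ _).1
        ((Submodule.starProjection_apply_eq_zero_iff _).1 h1.symm) (Ψ (Y (i : ℕ)))
        (Submodule.subset_span ⟨⟨L + i, by omega⟩, by simp⟩)
      rw [hΨX, congrFun hΨY (i : ℕ), inner_smul_left, inner_basis_channelVec_natCast hb] at h2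
      simp [hp] at h2
      exact hi h2
    rw [hout L g hg]
    set U : ℤ → (Fin 3 × ℤ →₀ ℝ) :=
      fun k => ∑ i : Fin (2 * L + 1), g i • Y (k - (L : ℤ) + (i : ℕ)) with hU
    have hΨU : (fun k => Ψ (U k)) =
        fun k => ∑ i : Fin (2 * L + 1), g i • Ψ (Y (k - (L : ℤ) + (i : ℕ))) := by
      funext k
      simp [hU]
    have hstU : JointlyStationary (fun k => Ψ (X k)) (fun k => Ψ (U k)) := by
      have := hst.filter Finset.univ g fun i : Fin (2 * L + 1) => ((i : ℕ) : ℤ) - L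
      rw [hΨU]
      convert this using 6
      ring
    have hbessel := norm_sq_sum_channelVec_le hb h √(vx : ℝ) √(vz : ℝ) √(vw : ℝ)
    rw [← hΨY] at hbessel
    have hρU : JointlyStationary.limitEnergy (fun k => Ψ (X k)) (fun k => Ψ (U k)) = ρ := by
      rw [hρ, JointlyStationary.limitEnergy, JointlyStationary.limitEnergy, hΨU]
      have := topologicalClosure_span_filter hbessel hg0 L
      simp only [this]
    have hUY : Submodule.span ℝ (Set.range fun k => Ψ (U k)) ≤
        Submodule.span ℝ (Set.range fun k => Ψ (Y k)) := by
      rw [hΨU, Submodule.span_le]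
      rintro _ ⟨k, rfl⟩
      exact Submodule.sum_mem _ fun i _ => Submodule.smul_mem _ _ (Submodule.subset_span ⟨_, rfl⟩)
    have hblockU := eventually_mutualInfo_block_bounds hB hstU hvx' ht0 ht1 hX hXne
      (hρU ▸ hρ0) (fun W _ hW => hP W (hW.trans hUY))
    rw [hBX, hρU] at hblockU
    filter_upwards [hblock, hblockU, eventually_gt_atTop 0] with N h1 h2 hN
    exact abs_div_sub_one_lt (hm N hN) ht0 ht4 htε h2.1 h2.2 h1.1 h1.2
  · obtain ⟨S, hS⟩ := hst.exists_finset_le_norm_sq_starProjection (mul_pos hρ0 ht0)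
    rw [← hρ] at hS
    -- From here on the window around `k` contains `k + S`, so it captures at least `ρ * (1 - t)` at
    -- every time.
    filter_upwards [eventually_ge_atTop (S.sup Int.natAbs)] with L hL
    obtain ⟨g, hg, hgW⟩ := exists_lmmseTaps hB hst hli L
    rw [hBX, hBY] at hg
    rw [hout L g hg]
    have hsym : ∀ k : ℤ, ρ / (2 * vx) * (1 - t) ≤ (mutualInfo μ (x k)
        (B (∑ i : Fin (2 * L + 1), g i • Y (k - (L : ℤ) + (i : ℕ))))).toReal ∧
        (mutualInfo μ (x k) (B (∑ i : Fin (2 * L + 1), g i • Y (k - (L : ℤ) + (i : ℕ))))).toReal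
          ≤ ρ / (2 * vx) / (1 - t) := by
      intro k
      set W := Submodule.span ℝ (Set.range fun i : Fin (2 * L + 1) =>
        Ψ (Y (k - (L : ℤ) + (i : ℕ)))) with hW
      have hWY : W ≤ Submodule.span ℝ (Set.range fun k => Ψ (Y k)) :=
        Submodule.span_mono (by rintro _ ⟨i, rfl⟩; exact ⟨_, rfl⟩)
      have h1 := mutualInfo_projection_bounds hB hvx' ht1 (hX k) W
        (V := ∑ i : Fin (2 * L + 1), g i • Y (k - (L : ℤ) + (i : ℕ)))
        (by rw [← hgW k, map_sum]; simp)
        (fun W' _ hW' e he => hP W' (hW'.trans hWY) e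
          (Submodule.span_mono (by rintro _ rfl; exact ⟨k, rfl⟩) he))
      have h2 := hst.norm_sq_starProjection_le W hWY k
      have h3 := hS k W fun j hj => Submodule.subset_span (by
        have hj' : j.natAbs ≤ L := (Finset.le_sup (f := Int.natAbs) hj).trans hL
        refine ⟨⟨(j + L).toNat, by omega⟩, ?_⟩
        simp only
        congr 2
        omega)
      rw [show B (X k) = x k from congrFun hBX k] at h1
      have h1t : 0 < 1 - t := by linarith
      refine ⟨le_trans ?_ h1.1, h1.2.trans ?_⟩
      · calc ρ / (2 * vx) * (1 - t) = (ρ - ρ * t) / (2 * vx) := by ring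
          _ ≤ _ := by gcongr
      · rw [div_div]
        gcongr
    filter_upwards [hblock, eventually_gt_atTop 0] with N h1 hN
    refine abs_div_sub_one_lt (hm N hN) ht0 ht4 htε ?_ ?_ h1.1 h1.2
    · have := Finset.sum_le_sum fun k (_ : k ∈ Finset.range N) => (hsym (k : ℤ)).1
      simp only [Finset.sum_const, Finset.card_range, nsmul_eq_mul] at this
      refine le_trans (le_of_eq ?_) this
      ring
    · have := Finset.sum_le_sum fun k (_ : k ∈ Finset.range N) => (hsym (k : ℤ)).2
      simp only [Finset.sum_const, Finset.card_range, nsmul_eq_mul] at this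
      refine this.trans (le_of_eq ?_)
      ring
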